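/- Let $p,r,q,a,b,c,z$ be complex numbers with $|p|<1$, $r^3=p$ (so $r$ is any choice of $p^{1/3}$) and $q,a,b,c,z\neq 0$, and let $n\ge 0$ be an integer. For $x\neq 0$ and $|t|<1$ let $$\theta(x;t)=\prod_{j\ge 0}(1-t^jx)(1-t^{j+1}/x),\qquad \gamma(u,v;t)=\sum_{k\in\mathbb Z}\sum_{l\in\mathbb Z}t^{k^2+kl+l^2}v^{k+l}u^{k-l}$$ be the modified Jacobi theta function and Bhargava's cubic theta function, and write $$(x;q,p)_m=\prod_{j=0}^{m-1}\theta(xq^j;p),\qquad (x_1,\dots,x_s;q,p)_m=\prod_{i=1}^s(x_i;q,p)_m .$$ For $x,y\ne 0$ define the second cubic theta shifted factorial with base $p^{1/3}$ by $$\langle\langle xy,x/y;q,p^{1/3}\rangle\rangle_m=\prod_{j=0}^{m-1}\gamma\big(xq^{\frac{m-1}2},\,yq^{\frac{1-m}2+j};\,r\big).$$ This depends only on the pair $(xy,x/y)$ and on $q$, $r$, $m$, not on the choice of the square root $q^{1/2}$, nor on which of the two possible pairs $\pm(x,y)$ is used. Assume that no denominator below vanishes, that is, $\theta(acq^{-1};p)\ne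 0$ and $(q,acq^n,cz,c/z;q,p)_n\neq 0$. Then $$\frac{\langle\langle bz,b/z;q,p^{1/3}\rangle\rangle_n}{(cz,c/z;q,p)_n}\,(ac,c/a;q,p)_n=\sum_{k=0}^n q^{nk}\Big(\frac ca\Big)^k\frac{\theta(acq^{2k-1};p)}{\theta(acq^{-1};p)}\,\frac{(q^{-n},acq^{-1},az,a/z;q,p)_k}{(q,acq^n,cz,c/z;q,p)_k}\,\langle\langle bcq^{n-1},bq^{1-k}/c;q,p^{1/3}\rangle\rangle_k\,\langle\langle abq^k,b/a;q,p^{1/3}\rangle\rangle_{n-k}.$$ -/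

import Mathlib

noncomputable section

/-- The modified Jacobi theta function `θ(x;p) = ∏_{j ≥ 0} (1 - p^j x)(1 - p^{j+1}/x)`
(absolutely convergent for `‖p‖ < 1` and `x ≠ 0`). -/
def modTheta (x p : ℂ) : ℂ :=
  ∏' j : ℕ, (1 - p ^ j * x) * (1 - p ^ (j + 1) / x)

/-- The theta shifted factorial `(a;q,p)_n = ∏_{k=0}^{n-1} θ(a q^k;p)`, for `n ≥ 0`. -/
def thetaPoch (a q p : ℂ) (n : ℕ) : ℂ :=
  ∏ k ∈ Finset.range n, modTheta (a * q ^ k) p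

/-- The compact notation `(a₁,…,a_m;q,p)_n = (a₁;q,p)_n ⋯ (a_m;q,p)_n`. -/
def thetaPochs (l : List ℂ) (q p : ℂ) (n : ℕ) : ℂ :=
  (l.map fun a => thetaPoch a q p n).prod

/-- Bhargava's cubic theta function
`γ(z,a;p) = ∑_{k,l ∈ ℤ} p^{k²+kl+l²} a^{k+l} z^{k-l}`
(absolutely convergent for `‖p‖ < 1` and `z, a ≠ 0`). -/
def cubicTheta (z a p : ℂ) : ℂ :=
  ∑' m : ℤ × ℤ,
    p ^ (m.1 ^ 2 + m.1 * m.2 + m.2 ^ 2) * a ^ (m.1 + m.2) * z ^ (m.1 - m.2)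

/-- The second cubic theta shifted factorial `⟨⟨A, B; q, r⟩⟩_n`, where `r` stands for `p^{1/3}`.
Writing `A = a z` and `B = a / z`, it is
`∏_{j=0}^{n-1} γ(a q^{(n-1)/2}, z q^{(1-n)/2+j}; r)`.
The numbers `a`, `z` are recovered from `A`, `B` by `a = (A B)^{1/2}`, `z = A / a`; by
`cubicPoch_mul_div` below, the value depends neither on the choice of this square root nor on
that of `q^{1/2}`. -/
def cubicPoch (A B q r : ℂ) (n : ℕ) : ℂ :=
  ∏ j ∈ Finset.range n,
    cubicTheta ((A * B) ^ (1 / 2 : ℂ) * (q ^ (1 / 2 : ℂ)) ^ ((n : ℤ) - 1))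
      (A / (A * B) ^ (1 / 2 : ℂ) * (q ^ (1 / 2 : ℂ)) ^ (1 - (n : ℤ)) * q ^ j) r

theorem cubicTheta_neg_neg (z a p : ℂ) : cubicTheta (-z) (-a) p = cubicTheta z a p := by
  unfold cubicTheta
  refine tsum_congr fun m => ?_
  rcases Int.even_or_odd (m.1 + m.2) with h | h
  · have h' : Even (m.1 - m.2) := by
      rw [Int.even_sub]; rwa [Int.even_add] at h
    rw [h.neg_zpow, h'.neg_zpow]
  · have h' : Odd (m.1 - m.2) := by
      rw [Int.odd_sub]; rwa [Int.odd_add] at h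
    rw [h.neg_zpow, h'.neg_zpow]
    ring

/-- The defining formula of `⟨⟨a z, a / z; q, r⟩⟩_n`, for any choice `s` of `q^{1/2}`. -/
theorem cubicPoch_mul_div (a z s r : ℂ) (ha : a ≠ 0) (hz : z ≠ 0) (n : ℕ) :
    cubicPoch (a * z) (a / z) (s ^ 2) r n =
      ∏ j ∈ Finset.range n,
        cubicTheta (a * s ^ ((n : ℤ) - 1)) (z * s ^ (1 - (n : ℤ)) * (s ^ 2) ^ j) r := by
  have key : ∀ x : ℂ, (x ^ 2) ^ (1 / 2 : ℂ) = x ∨ (x ^ 2) ^ (1 / 2 : ℂ) = -x := by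
    intro x
    have h : ((x ^ 2) ^ (1 / 2 : ℂ)) ^ 2 = x ^ 2 := by
      rw [one_div]
      exact Complex.cpow_ofNat_inv_pow (x ^ 2) 2
    exact sq_eq_sq_iff_eq_or_eq_neg.mp h
  have hprod : a * z * (a / z) = a ^ 2 := by field_simp
  unfold cubicPoch
  refine Finset.prod_congr rfl fun j _ => ?_
  rw [hprod]
  have hroot : ∀ t : ℂ, t = s ∨ t = -s →
      cubicTheta (a * t ^ ((n : ℤ) - 1)) (z * t ^ (1 - (n : ℤ)) * (s ^ 2) ^ j) r =
        cubicTheta (a * s ^ ((n : ℤ) - 1)) (z * s ^ (1 - (n : ℤ)) * (s ^ 2) ^ j) r := by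
    rintro t (rfl | rfl)
    · rfl
    · rcases Int.even_or_odd ((n : ℤ) - 1) with h | h
      · have h' : Even (1 - (n : ℤ)) := by
          rw [← neg_sub]; exact h.neg
        rw [h.neg_zpow, h'.neg_zpow]
      · have h' : Odd (1 - (n : ℤ)) := by
          rw [← neg_sub]; exact h.neg
        rw [h.neg_zpow, h'.neg_zpow, mul_neg, mul_neg, neg_mul, cubicTheta_neg_neg]
  rw [← hroot _ (key s)]
  rcases key a with h | h
  · rw [h, mul_div_cancel_left₀ z ha]
  · rw [h]
    have : a * z / -a = -z := by field_simp
    rw [this, neg_mul, neg_mul, neg_mul, cubicTheta_neg_neg]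

end

/-! Write `E` and `O` for the series `thetaEven` and `thetaOdd` of nome `p = r ^ 3`. Everything
takes place in the plane spanned by `E` and `O`. Diagonalising `k² + kl + l²` shows that `z ↦ γ(b,
z; r)` lies in this plane (`cubicTheta_eq`). The triple product shows that `θ(cz)θ(c/z)` is, up to a
factor `W * c`, the determinant of the vectors `(E, O)` at `c` and `z`
(`modTheta_mul_modTheta_div`). Linear algebra in dimension two then gives Weierstrass' formula
(`modTheta_addition`) as a Plücker relation, and an expression of `γ(b, z)` through `γ(b, a)` and
`γ(b, c)` (`cubicTheta_addition`).

The product of the `γ(β, y q^j)`, `j < n`, is expanded by induction on `n` (`shiftProd_eq_sum`). In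
the `k`-th term the new factor is written through the next value on the progression of `κ` and the
value just before the block already used on the progression of `α`. The coefficients,
`expansionCoeff`, therefore obey a Pascal-type recurrence, which Weierstrass' formula verifies. The
integer `e` is the offset of the `α`-progression, and it moves by one at each induction step.

The theorem is the case `α = a s^(1-n)`, `κ = c s^(n-1)`, `y = z s^(1-n)`, `β = b s^(n-1)` with `s²
= q`. The induction divides by theta values absent from the final denominators, so it is run for
generic `c`. The excluded `c` form a countable set, and continuity in `c` gives the remaining cases
(`cubicTheta_expansion`). -/

open Filter Topology

/-! ### Laurent series with quadratic exponents: convergence and continuity. -/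

/-- The Laurent series `∑_{n ∈ ℤ} p ^ Q n * x ^ n`. -/
noncomputable def laurentSeries (Q : ℤ → ℤ) (p x : ℂ) : ℂ := ∑' n : ℤ, p ^ Q n * x ^ n

/-- Exponents growing at least as fast as the triangular numbers. -/
def TriangularGrowth (Q : ℤ → ℤ) : Prop := ∀ n : ℤ, n ^ 2 - |n| ≤ 2 * Q n

theorem TriangularGrowth.choose_le {Q : ℤ → ℤ} (hQ : TriangularGrowth Q) (n : ℤ) :
    ((n.natAbs.choose 2 : ℕ) : ℤ) ≤ Q n := by
  have h := hQ n
  have h2 : (((n.natAbs.choose 2 : ℕ) : ℤ)) * 2 = n ^ 2 - |n| := by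
    have h3 : n.natAbs.choose 2 * 2 = n.natAbs * (n.natAbs - 1) := by
      rw [Nat.choose_two_right]
      exact Nat.div_mul_cancel (Nat.even_mul_pred_self _).two_dvd
    have h4 : ((n.natAbs.choose 2 * 2 : ℕ) : ℤ) = ((n.natAbs * (n.natAbs - 1) : ℕ) : ℤ) := by
      rw [h3]
    have h5 : ((n.natAbs * (n.natAbs - 1) : ℕ) : ℤ) = |n| ^ 2 - |n| := by
      rcases Nat.eq_zero_or_pos n.natAbs with h0 | h0
      · simp [Int.natAbs_eq_zero.mp h0]
      · rw [Nat.cast_mul, Nat.cast_sub h0, Int.natCast_natAbs]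
        push_cast
        ring
    rw [sq_abs] at h5
    rw [← h5, ← h4]
    push_cast
    ring
  linarith

theorem TriangularGrowth.nonneg {Q : ℤ → ℤ} (hQ : TriangularGrowth Q) (n : ℤ) : 0 ≤ Q n :=
  le_trans (by positivity) (hQ.choose_le n)

/-- The ratio of consecutive terms is `ρ ^ n * R`, which tends to zero whatever the size of `R`. -/
theorem summable_nat_pow_choose_two {ρ R : ℝ} (h0 : 0 < ρ) (h1 : ρ < 1) (hR : 0 < R) :
    Summable fun n : ℕ => ρ ^ n.choose 2 * R ^ n := by
  refine summable_of_ratio_test_tendsto_lt_one (l := 0) zero_lt_one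
    (Eventually.of_forall fun n => by positivity) ?_
  have h : Tendsto (fun n : ℕ => ρ ^ n * R) atTop (𝓝 0) := by
    simpa using (tendsto_pow_atTop_nhds_zero_of_lt_one h0.le h1).mul_const R
  refine h.congr fun n => ?_
  have e : (n + 1).choose 2 = n + n.choose 2 := by
    rw [Nat.choose_succ_succ' n 1, Nat.choose_one_right]
  rw [Real.norm_of_nonneg (by positivity), Real.norm_of_nonneg (by positivity), e, pow_add,
    pow_succ]
  field_simp

theorem summable_int_pow_choose_two {ρ R : ℝ} (h0 : 0 < ρ) (h1 : ρ < 1) (hR : 0 < R) :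
    Summable fun n : ℤ => ρ ^ n.natAbs.choose 2 * R ^ n.natAbs := by
  refine Summable.of_nat_of_neg ?_ ?_ <;>
  simpa using summable_nat_pow_choose_two h0 h1 hR

/-- Uniform bound for the terms of `laurentSeries` on the annulus `R⁻¹ ≤ ‖x‖ ≤ R`. -/
theorem norm_laurentSeries_term_le {Q : ℤ → ℤ} (hQ : TriangularGrowth Q) {p x : ℂ} {ρ R : ℝ}
    (hp : ‖p‖ ≤ ρ) (h1 : ρ < 1) (hx : ‖x‖ ≤ R) (hx' : ‖x‖⁻¹ ≤ R) (n : ℤ) :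
    ‖p ^ Q n * x ^ n‖ ≤ ρ ^ n.natAbs.choose 2 * R ^ n.natAbs := by
  have hρ : 0 ≤ ρ := (norm_nonneg p).trans hp
  rw [norm_mul, norm_zpow, norm_zpow]
  refine mul_le_mul ?_ ?_ (zpow_nonneg (norm_nonneg _) _) (by positivity)
  · obtain ⟨m, hm⟩ := Int.eq_ofNat_of_zero_le (hQ.nonneg n)
    have hle := hQ.choose_le n
    rw [hm] at hle ⊢
    rw [zpow_natCast]
    exact (pow_le_pow_left₀ (norm_nonneg _) hp m).trans
      (pow_le_pow_of_le_one hρ h1.le (by exact_mod_cast hle))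
  · obtain ⟨m, rfl | rfl⟩ := n.eq_nat_or_neg
    · rw [zpow_natCast, Int.natAbs_natCast]
      exact pow_le_pow_left₀ (norm_nonneg _) hx m
    · rw [zpow_neg, zpow_natCast, Int.natAbs_neg, Int.natAbs_natCast, ← inv_pow]
      exact pow_le_pow_left₀ (by positivity) hx' m

theorem summable_norm_laurentSeries {Q : ℤ → ℤ} (hQ : TriangularGrowth Q) {p x : ℂ}
    (hp : ‖p‖ < 1) (hx : x ≠ 0) : Summable fun n : ℤ => ‖p ^ Q n * x ^ n‖ := by
  -- The majorant needs a strictly positive base, while `p` may be zero; hence the maximum with `1 /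
  -- 2`.
  have hρ : max ‖p‖ (1 / 2) < 1 := max_lt hp (by norm_num)
  exact Summable.of_nonneg_of_le (fun _ => norm_nonneg _)
    (norm_laurentSeries_term_le hQ (le_max_left _ (1 / 2)) hρ (le_max_left _ ‖x‖⁻¹)
      (le_max_right _ _))
    (summable_int_pow_choose_two (lt_max_of_lt_right (by norm_num)) hρ
      (lt_max_of_lt_left (norm_pos_iff.mpr hx)))

theorem hasSum_laurentSeries {Q : ℤ → ℤ} (hQ : TriangularGrowth Q) {p x : ℂ}
    (hp : ‖p‖ < 1) (hx : x ≠ 0) :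
    HasSum (fun n : ℤ => p ^ Q n * x ^ n) (laurentSeries Q p x) :=
  (summable_norm_laurentSeries hQ hp hx).of_norm.hasSum

theorem continuousAt_laurentSeries {Q : ℤ → ℤ} (hQ : TriangularGrowth Q) {p x : ℂ}
    (hp : ‖p‖ < 1) (hx : x ≠ 0) : ContinuousAt (laurentSeries Q p) x := by
  have hρ : max ‖p‖ (1 / 2) < 1 := max_lt hp (by norm_num)
  have hxp := norm_pos_iff.mpr hx
  set R := max (2 * ‖x‖) (2 * ‖x‖⁻¹)
  let s : Set ℂ := {y | ‖y‖ < 2 * ‖x‖ ∧ ‖x‖ / 2 < ‖y‖}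
  have hs : IsOpen s :=
    (isOpen_lt continuous_norm continuous_const).inter (isOpen_lt continuous_const continuous_norm)
  have hxs : x ∈ s := ⟨by linarith, by linarith⟩
  have hne : ∀ y ∈ s, y ≠ 0 := fun y hy => by
    have := hy.2
    exact norm_pos_iff.mp (by linarith)
  have : ContinuousOn (laurentSeries Q p) s := by
    refine continuousOn_tsum (u := fun n : ℤ => (max ‖p‖ (1 / 2)) ^ n.natAbs.choose 2 * R ^ n.natAbs)
      ?_ (summable_int_pow_choose_two (lt_max_of_lt_right (by norm_num)) hρ
        (lt_max_of_lt_left (by positivity))) ?_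
    · intro n
      exact continuousOn_const.mul (continuousOn_id.zpow₀ n fun y hy => Or.inl (hne y hy))
    · intro n y hy
      refine norm_laurentSeries_term_le hQ (le_max_left _ (1 / 2)) hρ
        (hy.1.le.trans (le_max_left _ _)) (le_trans ?_ (le_max_right _ _)) n
      have h2 : 2 * ‖x‖⁻¹ = (‖x‖ / 2)⁻¹ := by
        rw [inv_div]; rfl
      rw [h2]
      exact inv_anti₀ (by positivity) hy.2.le
  exact this.continuousAt (hs.mem_nhds hxs)

theorem triangularGrowth_sq : TriangularGrowth fun n => n ^ 2 := fun n => by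
  have := abs_nonneg n
  have := sq_nonneg n
  simp only
  linarith

theorem abs_le_sq_int (n : ℤ) : |n| ≤ n ^ 2 := by
  rw [← sq_abs]
  exact Int.le_self_sq |n|

theorem triangularGrowth_sq_add_self : TriangularGrowth fun n => n ^ 2 + n := fun n => by
  have := abs_le_sq_int n
  have := neg_abs_le n
  simp only
  linarith

theorem two_mul_triangular (n : ℤ) : 2 * (n * (n - 1) / 2) = n * (n - 1) :=
  Int.mul_ediv_cancel' (Int.even_mul_pred_self n).two_dvd

theorem triangularGrowth_triangular : TriangularGrowth fun n => n * (n - 1) / 2 := fun n => by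
  have := le_abs_self n
  simp only [two_mul_triangular]
  linarith

/-! ### The even and odd theta series, and the splitting of the cubic theta function. -/

/-- `∑_{n ∈ ℤ} p ^ (n²) y ^ (2n)`. -/
noncomputable def thetaEven (p y : ℂ) : ℂ := laurentSeries (fun n => n ^ 2) p (y ^ 2)

/-- `∑_{n ∈ ℤ} p ^ (n² + n) y ^ (2n + 1)`. -/
noncomputable def thetaOdd (p y : ℂ) : ℂ := y * laurentSeries (fun n => n ^ 2 + n) p (y ^ 2)

theorem hasSum_thetaEven {p y : ℂ} (hp : ‖p‖ < 1) (hy : y ≠ 0) :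
    HasSum (fun n : ℤ => p ^ (n ^ 2) * y ^ (2 * n)) (thetaEven p y) := by
  simpa [thetaEven, zpow_mul, zpow_ofNat] using
    hasSum_laurentSeries triangularGrowth_sq hp (pow_ne_zero 2 hy)

theorem hasSum_thetaOdd {p y : ℂ} (hp : ‖p‖ < 1) (hy : y ≠ 0) :
    HasSum (fun n : ℤ => p ^ (n ^ 2 + n) * y ^ (2 * n + 1)) (thetaOdd p y) := by
  have h := (hasSum_laurentSeries triangularGrowth_sq_add_self hp (pow_ne_zero 2 hy)).mul_left y
  refine h.congr_fun fun n => ?_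
  rw [zpow_add₀ hy, zpow_mul, zpow_one, zpow_ofNat]
  ring

theorem continuousAt_thetaEven {p y : ℂ} (hp : ‖p‖ < 1) (hy : y ≠ 0) :
    ContinuousAt (thetaEven p) y :=
  ContinuousAt.comp (f := fun y : ℂ => y ^ 2) (g := laurentSeries (fun n => n ^ 2) p)
    (continuousAt_laurentSeries triangularGrowth_sq hp (pow_ne_zero 2 hy))
    (continuous_pow 2).continuousAt

theorem continuousAt_thetaOdd {p y : ℂ} (hp : ‖p‖ < 1) (hy : y ≠ 0) :
    ContinuousAt (thetaOdd p) y :=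
  continuousAt_id.mul
    (ContinuousAt.comp (f := fun y : ℂ => y ^ 2) (g := laurentSeries (fun n => n ^ 2 + n) p)
      (continuousAt_laurentSeries triangularGrowth_sq_add_self hp (pow_ne_zero 2 hy))
      (continuous_pow 2).continuousAt)

/-- Splitting a sum over `ℤ × ℤ` according to the parity of the sum of the two indices. -/
theorem hasSum_of_parity {F : ℤ × ℤ → ℂ} {A B : ℂ}
    (hA : HasSum (fun m : ℤ × ℤ => F (m.1 + m.2, m.1 - m.2)) A)
    (hB : HasSum (fun m : ℤ × ℤ => F (m.1 + m.2 + 1, m.1 - m.2)) B) : HasSum F (A + B) := by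
  let f : ℤ × ℤ → ℤ × ℤ := fun m => (m.1 + m.2, m.1 - m.2)
  let g : ℤ × ℤ → ℤ × ℤ := fun m => (m.1 + m.2 + 1, m.1 - m.2)
  have hf : Function.Injective f := by
    rintro ⟨a, b⟩ ⟨c, d⟩ h
    simp only [f, Prod.mk.injEq] at h ⊢
    omega
  have hg : Function.Injective g := by
    rintro ⟨a, b⟩ ⟨c, d⟩ h
    simp only [g, Prod.mk.injEq] at h ⊢
    omega
  suffices hfg : Set.range g = (Set.range f)ᶜ by
    have h : IsCompl (Set.range f) (Set.range g) := hfg ▸ isCompl_compl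
    exact HasSum.add_isCompl h (hf.hasSum_range_iff.mpr hA) (hg.hasSum_range_iff.mpr hB)
  ext ⟨a, b⟩
  simp only [f, g, Set.mem_range, Set.mem_compl_iff, Prod.exists, Prod.mk.injEq, not_exists]
  constructor
  · rintro ⟨c, d, h⟩ x y h'
    omega
  · intro h
    have := h ((a + b) / 2) ((a - b) / 2)
    exact ⟨(a + b - 1) / 2, (a - b - 1) / 2, by omega⟩

theorem HasSum.mul_of_complex {f g : ℤ → ℂ} {A B : ℂ} (hf : HasSum f A) (hg : HasSum g B) :
    HasSum (fun m : ℤ × ℤ => f m.1 * g m.2) (A * B) :=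
  hf.mul hg (summable_mul_of_summable_norm hf.summable.norm hg.summable.norm)

/-- Replaces `zpow_add₀`, so that base zero needs no separate treatment. -/
theorem zpow_add_of_nonneg (r : ℂ) {m n : ℤ} (hm : 0 ≤ m) (hn : 0 ≤ n) :
    r ^ (m + n) = r ^ m * r ^ n := by
  lift m to ℕ using hm
  lift n to ℕ using hn
  exact_mod_cast pow_add r m n

theorem sq_add_self_nonneg (n : ℤ) : 0 ≤ n ^ 2 + n := triangularGrowth_sq_add_self.nonneg n

theorem sq_sub_self_nonneg (n : ℤ) : 0 ≤ n ^ 2 - n := by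
  simpa using sq_add_self_nonneg (-n)

/-- Put `k = M + N`, `l = M - N` when `k + l` is even, and `k = M + N + 1`, `l = M - N` when it is
odd. The form `k² + kl + l²` becomes `3M² + N²`, respectively `3(M² + M) + (N² + N) + 1`, and each
double sum factors. The coefficient 3 is the source of the nome `r ^ 3`. -/
theorem cubicTheta_eq {r x y : ℂ} (hr : ‖r‖ < 1) (hx : x ≠ 0) (hy : y ≠ 0) :
    cubicTheta x y r =
      thetaEven (r ^ 3) y * thetaEven r x + thetaOdd (r ^ 3) y * (r * thetaOdd r x) := by
  have hr3 : ‖r ^ 3‖ < 1 := by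
    rw [norm_pow]
    exact pow_lt_one₀ (norm_nonneg r) hr (by norm_num)
  have h3 : ∀ k : ℤ, (r ^ 3) ^ k = r ^ (3 * k) := fun k => by rw [zpow_mul, zpow_ofNat]
  refine (hasSum_of_parity ?_ ?_).tsum_eq
  · refine ((hasSum_thetaEven hr3 hy).mul_of_complex (hasSum_thetaEven hr hx)).congr_fun ?_
    rintro ⟨M, N⟩
    simp only [h3]
    have e : (M + N) ^ 2 + (M + N) * (M - N) + (M - N) ^ 2 = 3 * M ^ 2 + N ^ 2 := by ring
    rw [e, zpow_add_of_nonneg r (by positivity) (by positivity), show M + N + (M - N) = 2 * M by ring,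
      show M + N - (M - N) = 2 * N by ring]
    ring
  · refine ((hasSum_thetaOdd hr3 hy).mul_of_complex
      ((hasSum_thetaOdd hr hx).mul_left r)).congr_fun ?_
    rintro ⟨M, N⟩
    simp only [h3]
    have e : (M + N + 1) ^ 2 + (M + N + 1) * (M - N) + (M - N) ^ 2 =
      3 * (M ^ 2 + M) + ((N ^ 2 + N) + 1) := by ring
    have hM := sq_add_self_nonneg M
    have hN := sq_add_self_nonneg N
    rw [e, zpow_add_of_nonneg r (by positivity) (by positivity),
      zpow_add_of_nonneg r hN (by positivity), zpow_one,
      show M + N + 1 + (M - N) = 2 * M + 1 by ring,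
      show M + N + 1 - (M - N) = 2 * N + 1 by ring]
    ring

/-! ### The infinite product for `θ`: convergence and zeros. -/

theorem summable_modTheta_factor_sub_one {p : ℂ} (hp : ‖p‖ < 1) (x : ℂ) :
    Summable fun j : ℕ => ‖(1 - p ^ j * x) * (1 - p ^ (j + 1) / x) - 1‖ := by
  have h1 : Summable fun j : ℕ => p ^ j := summable_geometric_of_norm_lt_one hp
  have h2 : Summable fun j : ℕ => (p ^ 2) ^ j := summable_geometric_of_norm_lt_one (by
    rw [norm_pow]; exact pow_lt_one₀ (norm_nonneg p) hp two_ne_zero)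
  have h3 := ((h1.mul_right x).add (h1.mul_right (p / x))).neg.add (h2.mul_right (x * (p / x)))
  refine (h3.congr fun j => ?_).norm
  rw [← pow_mul, pow_mul', pow_succ]
  ring

theorem multipliable_modTheta {p : ℂ} (hp : ‖p‖ < 1) (x : ℂ) :
    Multipliable fun j : ℕ => (1 - p ^ j * x) * (1 - p ^ (j + 1) / x) := by
  simpa using multipliable_one_add_of_summable (summable_modTheta_factor_sub_one hp x)

theorem exists_factor_eq_zero_of_modTheta_eq_zero {p x : ℂ} (hp : ‖p‖ < 1)
    (h : modTheta x p = 0) : ∃ j : ℕ, (1 - p ^ j * x) * (1 - p ^ (j + 1) / x) = 0 := by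
  by_contra! hne
  refine tprod_one_add_ne_zero_of_summable
    (f := fun j : ℕ => (1 - p ^ j * x) * (1 - p ^ (j + 1) / x) - 1) (fun j => ?_)
    (summable_modTheta_factor_sub_one hp x) ?_
  · simpa using hne j
  · simpa [modTheta] using h

theorem countable_modTheta_zeros {p : ℂ} (hp : ‖p‖ < 1) :
    {x : ℂ | modTheta x p = 0}.Countable := by
  refine Set.Countable.mono (s₂ := ⋃ j : ℕ, {(p ^ j)⁻¹, p ^ (j + 1)}) ?_
    (Set.countable_iUnion fun j => (Set.toFinite _).countable)
  intro x hx
  obtain ⟨j, hj⟩ := exists_factor_eq_zero_of_modTheta_eq_zero hp hx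
  refine Set.mem_iUnion.mpr ⟨j, ?_⟩
  rcases mul_eq_zero.mp hj with h | h
  · exact Or.inl (eq_inv_of_mul_eq_one_right (sub_eq_zero.mp h).symm)
  · have hx0 : x ≠ 0 := by
      rintro rfl
      simp at h
    have := (sub_eq_zero.mp h).symm
    rw [div_eq_one_iff_eq hx0] at this
    exact Or.inr this.symm

/-! ### The Jacobi triple product, as a limit of its finite form. -/

/-- The finite product `(p;p)_n`. -/
noncomputable def eulerPoch (p : ℂ) (n : ℕ) : ℂ := ∏ j ∈ Finset.range n, (1 - p ^ (j + 1))

/-- `1 / (p;p)_m`, extended by zero to negative `m`. -/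
noncomputable def invEulerPoch (p : ℂ) (m : ℤ) : ℂ := if m < 0 then 0 else (eulerPoch p m.toNat)⁻¹

theorem one_sub_pow_succ_ne_zero {p : ℂ} (hp : ‖p‖ < 1) (j : ℕ) : 1 - p ^ (j + 1) ≠ 0 := by
  intro h
  have h1 : ‖p ^ (j + 1)‖ < 1 := by
    rw [norm_pow]; exact pow_lt_one₀ (norm_nonneg p) hp (by omega)
  rw [← sub_eq_zero.mp h, norm_one] at h1
  exact lt_irrefl _ h1

theorem eulerPoch_ne_zero {p : ℂ} (hp : ‖p‖ < 1) (n : ℕ) : eulerPoch p n ≠ 0 :=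
  Finset.prod_ne_zero_iff.mpr fun j _ => one_sub_pow_succ_ne_zero hp j

theorem tendsto_eulerPoch {p : ℂ} (hp : ‖p‖ < 1) :
    ∃ E : ℂ, E ≠ 0 ∧ Tendsto (eulerPoch p) atTop (𝓝 E) := by
  have h : Summable fun j : ℕ => ‖-p ^ (j + 1)‖ := by
    simpa [pow_succ] using ((summable_geometric_of_norm_lt_one hp).mul_right p).norm
  refine ⟨∏' j : ℕ, (1 + -p ^ (j + 1)), tprod_one_add_ne_zero_of_summable (fun j => ?_) h, ?_⟩
  · simpa [sub_eq_add_neg] using one_sub_pow_succ_ne_zero hp j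
  · refine (multipliable_one_add_of_summable h).hasProd.tendsto_prod_nat.congr fun n => ?_
    simp only [eulerPoch, sub_eq_add_neg]

/-- The extension by zero is consistent: at `m = 0` the factor `1 - p ^ 0` vanishes. The recurrence
for `tripleCoeff` thus holds for every integer `n`, with no boundary cases. -/
theorem invEulerPoch_pred {p : ℂ} (hp : ‖p‖ < 1) {m m' : ℤ} (h : m = m' + 1) :
    invEulerPoch p m' = (1 - p ^ m) * invEulerPoch p m := by
  subst h
  rcases lt_or_ge m' 0 with h | h
  · rcases eq_or_lt_of_le (show m' + 1 ≤ 0 by omega) with h0 | h0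
    · simp [invEulerPoch, h, h0]
    · simp [invEulerPoch, h, h0]
  · lift m' to ℕ using h
    have h1 : ¬ ((m' : ℤ) < 0) := by omega
    have h2 : ¬ ((m' : ℤ) + 1 < 0) := by omega
    have h3 : ((m' : ℤ) + 1).toNat = m' + 1 := by omega
    have h4 := one_sub_pow_succ_ne_zero hp m'
    have h5 := eulerPoch_ne_zero hp m'
    have h6 : p ^ ((m' : ℤ) + 1) = p ^ (m' + 1) := by exact_mod_cast zpow_natCast p (m' + 1)
    rw [invEulerPoch, invEulerPoch, if_neg h1, if_neg h2, h3, Int.toNat_natCast, h6]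
    simp only [eulerPoch, Finset.prod_range_succ] at h5 ⊢
    field_simp

/-- The coefficients of the finite form of the Jacobi triple product. -/
noncomputable def tripleCoeff (p : ℂ) (N : ℕ) (n : ℤ) : ℂ :=
  p ^ (n * (n - 1) / 2) * (eulerPoch p (2 * N) * invEulerPoch p (N - n) * invEulerPoch p (N + n))

/-- Coefficient form of multiplication by `(1 + p ^ N t)(1 + p ^ (N + 1) / t)`, whose expansion is
`1 + p ^ (2N + 1) + p ^ N t + p ^ (N + 1) / t`. -/
theorem tripleCoeff_succ {p : ℂ} (hp : ‖p‖ < 1) (h0 : p ≠ 0) (N : ℕ) (n : ℤ) :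
    tripleCoeff p (N + 1) n = (1 + p ^ (2 * N + 1)) * tripleCoeff p N n
      + p ^ N * tripleCoeff p N (n - 1) + p ^ (N + 1) * tripleCoeff p N (n + 1) := by
  have e1 : (n - 1) * (n - 1 - 1) / 2 = n * (n - 1) / 2 + (1 - n) := by
    have h1 := two_mul_triangular n
    have h2 := two_mul_triangular (n - 1)
    have h3 : (n - 1) * (n - 1 - 1) = n * (n - 1) + 2 * (1 - n) := by ring
    omega
  have e2 : (n + 1) * (n + 1 - 1) / 2 = n * (n - 1) / 2 + n := by
    have h1 := two_mul_triangular n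
    have h2 := two_mul_triangular (n + 1)
    have h3 : (n + 1) * (n + 1 - 1) = n * (n - 1) + 2 * n := by ring
    omega
  have hE : eulerPoch p (2 * (N + 1)) =
      eulerPoch p (2 * N) * (1 - p ^ (2 * N + 1)) * (1 - p ^ (2 * N + 2)) := by
    rw [show 2 * (N + 1) = 2 * N + 1 + 1 by ring, eulerPoch, Finset.prod_range_succ,
      Finset.prod_range_succ, eulerPoch]
  unfold tripleCoeff
  rw [hE, e1, e2]
  push_cast
  -- All reciprocals are brought to the indices `N + 1 - n` and `N + 1 + n`; a rational identity in
  -- powers of `p` remains.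
  rw [invEulerPoch_pred hp (show (N : ℤ) + 1 - n = N - n + 1 by ring),
    invEulerPoch_pred hp (show (N : ℤ) + 1 + n = N + n + 1 by ring),
    show (N : ℤ) - (n - 1) = N + 1 - n by ring,
    invEulerPoch_pred hp (show (N : ℤ) + n = N + (n - 1) + 1 by ring),
    invEulerPoch_pred hp (show (N : ℤ) + 1 + n = N + n + 1 by ring),
    show (N : ℤ) + (n + 1) = N + 1 + n by ring,
    invEulerPoch_pred hp (show (N : ℤ) - n = N - (n + 1) + 1 by ring),
    invEulerPoch_pred hp (show (N : ℤ) + 1 - n = N - n + 1 by ring)]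
  have hn : p ^ n ≠ 0 := zpow_ne_zero n h0
  simp only [zpow_add₀ h0, zpow_sub₀ h0, zpow_one, zpow_natCast, pow_add, pow_mul', pow_two,
    pow_one]
  field_simp
  ring

theorem tripleCoeff_zero (p : ℂ) {n : ℤ} (hn : n ≠ 0) : tripleCoeff p 0 n = 0 := by
  rcases lt_or_gt_of_ne hn with h | h
  · simp [tripleCoeff, invEulerPoch, h]
  · simp [tripleCoeff, invEulerPoch, h]

/-- The finite form of the Jacobi triple product. -/
theorem hasSum_tripleCoeff {p t : ℂ} (hp : ‖p‖ < 1) (h0 : p ≠ 0) (ht : t ≠ 0) (N : ℕ) :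
    HasSum (fun n : ℤ => tripleCoeff p N n * t ^ n)
      (∏ j ∈ Finset.range N, (1 + p ^ j * t) * (1 + p ^ (j + 1) / t)) := by
  induction N with
  | zero =>
    convert hasSum_single (f := fun n : ℤ => tripleCoeff p 0 n * t ^ n) 0 fun n hn => by
      simp [tripleCoeff_zero p hn] using 1
    simp [tripleCoeff, invEulerPoch, eulerPoch]
  | succ N ih =>
    have h1 := ((Equiv.subRight (1 : ℤ)).hasSum_iff.mpr ih).mul_left (p ^ N * t)
    have h2 := ((Equiv.addRight (1 : ℤ)).hasSum_iff.mpr ih).mul_left (p ^ (N + 1) / t)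
    have h3 := ((ih.mul_left (1 + p ^ (2 * N + 1))).add h1).add h2
    rw [Finset.prod_range_succ]
    have hv : ∀ P : ℂ, P * ((1 + p ^ N * t) * (1 + p ^ (N + 1) / t)) =
        (1 + p ^ (2 * N + 1)) * P + p ^ N * t * P + p ^ (N + 1) / t * P := fun P => by
      field_simp
      ring
    rw [hv]
    refine h3.congr_fun fun n => ?_
    simp only [Function.comp, Equiv.subRight_apply, Equiv.coe_addRight, tripleCoeff_succ hp h0,
        zpow_add₀ ht, zpow_sub₀ ht, zpow_one]
    field_simp

theorem tendsto_invEulerPoch {p E : ℂ} (hE : E ≠ 0)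
    (h : Tendsto (eulerPoch p) atTop (𝓝 E)) :
    Tendsto (invEulerPoch p) atTop (𝓝 E⁻¹) := by
  have h1 : Tendsto (fun m : ℤ => (eulerPoch p m.toNat)⁻¹) atTop (𝓝 E⁻¹) := by
    have ht : Tendsto Int.toNat atTop atTop :=
      tendsto_atTop_atTop.mpr fun b => ⟨b, fun a ha => by omega⟩
    exact (h.comp ht).inv₀ hE
  refine h1.congr' ?_
  filter_upwards [eventually_ge_atTop 0] with m hm
  rw [invEulerPoch, if_neg (by omega)]

/-- The Jacobi triple product identity, up to the value of the constant. -/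
theorem modTheta_eq_laurentSeries {p : ℂ} (hp : ‖p‖ < 1) :
    ∃ w : ℂ, w ≠ 0 ∧ ∀ x : ℂ, x ≠ 0 →
      modTheta x p = w * laurentSeries (fun n => n * (n - 1) / 2) p (-x) := by
  -- The recurrence for the finite form uses negative powers of `p`. For `p = 0` only the exponents
  -- at `n = 0` and `n = 1` vanish, so both sides are `1 - x`.
  rcases eq_or_ne p 0 with rfl | h0
  · refine ⟨1, one_ne_zero, fun x hx => ?_⟩
    have h1 : modTheta x 0 = 1 - x := by
      rw [modTheta, tprod_eq_mulSingle 0 fun j hj => by simp [hj]]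
      simp
    have h2 : laurentSeries (fun n => n * (n - 1) / 2) 0 (-x) = 1 - x := by
      rw [laurentSeries, tsum_eq_sum (s := {0, 1}) fun n hn => ?_]
      · rw [Finset.sum_pair (by norm_num)]
        simp [sub_eq_add_neg]
      · simp only [Finset.mem_insert, Finset.mem_singleton, not_or] at hn
        have h3 : n * (n - 1) / 2 ≠ 0 := by
          intro h
          have := two_mul_triangular n
          rw [h, mul_zero, eq_comm, mul_eq_zero] at this
          omega
        rw [zero_zpow _ h3, zero_mul]
    rw [h1, h2, one_mul]
  · obtain ⟨E, hE, hlim⟩ := tendsto_eulerPoch hp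
    refine ⟨E⁻¹, inv_ne_zero hE, fun x hx => ?_⟩
    have hx' : -x ≠ 0 := neg_ne_zero.mpr hx
    have hw := tendsto_invEulerPoch hE hlim
    obtain ⟨B, hB⟩ := (Metric.isBounded_range_of_tendsto _ hlim).exists_norm_le
    obtain ⟨B', hB'⟩ := (Metric.isBounded_range_of_tendsto _ (hlim.inv₀ hE)).exists_norm_le
    have hB'0 : 0 ≤ B' := (norm_nonneg _).trans (hB' _ ⟨0, rfl⟩)
    have hB0 : 0 ≤ B := (norm_nonneg _).trans (hB _ ⟨0, rfl⟩)
    have hwB : ∀ m, ‖invEulerPoch p m‖ ≤ B' := fun m => by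
      unfold invEulerPoch
      split_ifs
      · simpa using hB'0
      · exact hB' _ ⟨m.toNat, rfl⟩
    have hprod : Tendsto
        (fun N : ℕ => ∏ j ∈ Finset.range N, (1 + p ^ j * -x) * (1 + p ^ (j + 1) / -x)) atTop
        (𝓝 (modTheta x p)) := by
      have := (multipliable_modTheta hp x).hasProd.tendsto_prod_nat
      simpa [sub_eq_add_neg, div_neg, modTheta] using this
    have hsum : Tendsto (fun N : ℕ => ∑' n : ℤ, tripleCoeff p N n * (-x) ^ n) atTop
        (𝓝 (∑' n : ℤ, E⁻¹ * (p ^ (n * (n - 1) / 2) * (-x) ^ n))) := by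
      -- `B` bounds `(p;p)_{2N}` and `B'` bounds the two reciprocals, uniformly in `N` and `n`. The
      -- limit coefficient is `E * E⁻¹ * E⁻¹ = E⁻¹`.
      refine tendsto_tsum_of_dominated_convergence
        (bound := fun n : ℤ => B * B' * B' * ‖p ^ (n * (n - 1) / 2) * (-x) ^ n‖)
        ((summable_norm_laurentSeries triangularGrowth_triangular hp hx').mul_left _) ?_ ?_
      · intro n
        have t1 : Tendsto (fun N : ℕ => eulerPoch p (2 * N)) atTop (𝓝 E) :=
          hlim.comp (tendsto_id.const_mul_atTop' two_pos)
        have t2 : Tendsto (fun N : ℕ => invEulerPoch p (N - n)) atTop (𝓝 E⁻¹) :=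
          hw.comp (tendsto_atTop_add_const_right _ (-n) tendsto_natCast_atTop_atTop)
        have t3 : Tendsto (fun N : ℕ => invEulerPoch p (N + n)) atTop (𝓝 E⁻¹) :=
          hw.comp (tendsto_atTop_add_const_right _ n tendsto_natCast_atTop_atTop)
        have t := (((t1.mul t2).mul t3).const_mul (p ^ (n * (n - 1) / 2))).mul_const ((-x) ^ n)
        have hv : p ^ (n * (n - 1) / 2) * (E * E⁻¹ * E⁻¹) * (-x) ^ n =
            E⁻¹ * (p ^ (n * (n - 1) / 2) * (-x) ^ n) := by
          rw [mul_inv_cancel₀ hE]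
          ring
        rw [hv] at t
        exact t
      · refine Eventually.of_forall fun N n => ?_
        rw [tripleCoeff, norm_mul, norm_mul, norm_mul, norm_mul, norm_mul]
        have b1 := hB _ ⟨2 * N, rfl⟩
        have b2 := hwB (N - n)
        have b3 := hwB (N + n)
        calc _ ≤ ‖p ^ (n * (n - 1) / 2)‖ * (B * B' * B') * ‖(-x) ^ n‖ := by gcongr
          _ = _ := by ring
    have heq : ∀ N : ℕ, ∏ j ∈ Finset.range N, (1 + p ^ j * -x) * (1 + p ^ (j + 1) / -x) =
        ∑' n : ℤ, tripleCoeff p N n * (-x) ^ n :=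
      fun N => (hasSum_tripleCoeff hp h0 hx' N).tsum_eq.symm
    rw [tendsto_nhds_unique hprod (hsum.congr fun N => (heq N).symm), tsum_mul_left,
      laurentSeries]

/-! ### Consequences of the triple product: continuity, inversion and addition formulas. -/

theorem continuousAt_modTheta {p x : ℂ} (hp : ‖p‖ < 1) (hx : x ≠ 0) :
    ContinuousAt (fun x => modTheta x p) x := by
  obtain ⟨w, -, h⟩ := modTheta_eq_laurentSeries hp
  have hc : ContinuousAt (fun x => w * laurentSeries (fun n => n * (n - 1) / 2) p (-x)) x :=
    continuousAt_const.mul (ContinuousAt.comp (f := fun x : ℂ => -x)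
      (continuousAt_laurentSeries triangularGrowth_triangular hp (neg_ne_zero.mpr hx))
      continuous_neg.continuousAt)
  refine hc.congr ?_
  filter_upwards [isOpen_ne.mem_nhds hx] with y hy
  exact (h y hy).symm

/-- The exponent `n(n - 1)/2` is invariant under `n ↦ 1 - n`. -/
theorem modTheta_inv {p x : ℂ} (hp : ‖p‖ < 1) (hx : x ≠ 0) :
    modTheta x⁻¹ p = -(modTheta x p / x) := by
  obtain ⟨w, -, h⟩ := modTheta_eq_laurentSeries hp
  rw [h x hx, h _ (inv_ne_zero hx)]
  have h1 := hasSum_laurentSeries triangularGrowth_triangular hp (neg_ne_zero.mpr hx)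
  have h2 := ((Equiv.subLeft (1 : ℤ)).hasSum_iff.mpr h1).mul_left (-x⁻¹)
  have h3 : laurentSeries (fun n => n * (n - 1) / 2) p (-x⁻¹) =
      -x⁻¹ * laurentSeries (fun n => n * (n - 1) / 2) p (-x) := by
    refine HasSum.tsum_eq (h2.congr_fun fun n => ?_)
    simp only [Function.comp, Equiv.subLeft_apply]
    rw [show (1 - n) * (1 - n - 1) = n * (n - 1) by ring, zpow_sub₀ (neg_ne_zero.mpr hx),
      ← inv_neg, inv_zpow, zpow_one]
    field_simp
  rw [h3]
  field_simp

/-- The product `θ(cz)θ(c/z)` as a determinant in the basis `thetaEven`, `thetaOdd`. -/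
theorem modTheta_mul_modTheta_div {p : ℂ} (hp : ‖p‖ < 1) :
    ∃ W : ℂ, W ≠ 0 ∧ ∀ c z : ℂ, c ≠ 0 → z ≠ 0 →
      modTheta (c * z) p * modTheta (c / z) p =
        W * c * (thetaOdd p c * thetaEven p z - thetaEven p c * thetaOdd p z) := by
  obtain ⟨w, hw, h⟩ := modTheta_eq_laurentSeries hp
  refine ⟨w ^ 2, pow_ne_zero 2 hw, fun c z hc hz => ?_⟩
  have hcz : -(c * z) ≠ 0 := neg_ne_zero.mpr (mul_ne_zero hc hz)
  have hcz' : -(c / z) ≠ 0 := neg_ne_zero.mpr (div_ne_zero hc hz)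
  rw [h _ (mul_ne_zero hc hz), h _ (div_ne_zero hc hz)]
  have hprod := (hasSum_laurentSeries triangularGrowth_triangular hp hcz).mul_of_complex
    (hasSum_laurentSeries triangularGrowth_triangular hp hcz')
  have hsgn : ∀ n : ℤ, (-1 : ℂ) ^ (2 * n) = 1 := fun n => by rw [zpow_mul]; simp
  -- Shifting the index by one gives the exponent `N² - N` produced by the terms with even index
  -- sum: the two triangular numbers at `N + M` and `N - M` add up to `N² - N + M²`.
  have hodd : HasSum (fun N : ℤ => p ^ (N ^ 2 - N) * c ^ (2 * N)) (c * thetaOdd p c) := by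
    have := ((Equiv.subRight (1 : ℤ)).hasSum_iff.mpr (hasSum_thetaOdd hp hc)).mul_left c
    refine this.congr_fun fun N => ?_
    simp only [Function.comp, Equiv.subRight_apply]
    rw [show (N - 1) ^ 2 + (N - 1) = N ^ 2 - N by ring, show 2 * (N - 1) + 1 = 2 * N - 1 by ring,
      zpow_sub₀ hc, zpow_one]
    field_simp
  have hsplit := hasSum_of_parity (F := fun m : ℤ × ℤ =>
      p ^ (m.1 * (m.1 - 1) / 2) * (-(c * z)) ^ m.1 * (p ^ (m.2 * (m.2 - 1) / 2) * (-(c / z)) ^ m.2))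
    (A := c * thetaOdd p c * thetaEven p z) (B := -c * (thetaEven p c * thetaOdd p z)) ?_ ?_
  · have := hprod.unique hsplit
    linear_combination w ^ 2 * this
  · refine (hodd.mul_of_complex (hasSum_thetaEven hp hz)).congr_fun ?_
    rintro ⟨N, M⟩
    have e : (N + M) * (N + M - 1) / 2 + (N - M) * (N - M - 1) / 2 = N ^ 2 - N + M ^ 2 := by
      have h1 := two_mul_triangular (N + M)
      have h2 := two_mul_triangular (N - M)
      linarith [show (N + M) * (N + M - 1) + (N - M) * (N - M - 1) = 2 * (N ^ 2 - N + M ^ 2) by ring]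
    have e2 := congrArg (p ^ ·) e
    simp only at e2 ⊢
    rw [zpow_add_of_nonneg p (triangularGrowth_triangular.nonneg _)
        (triangularGrowth_triangular.nonneg _),
      zpow_add_of_nonneg p (sq_sub_self_nonneg N) (by positivity)] at e2
    have e3 : (-(c * z)) ^ (N + M) * (-(c / z)) ^ (N - M) = c ^ (2 * N) * z ^ (2 * M) := by
      rw [neg_eq_neg_one_mul, neg_eq_neg_one_mul (c / z), mul_zpow, mul_zpow, mul_zpow, div_zpow]
      have hcc : c ^ (N + M) * c ^ (N - M) = c ^ (2 * N) := by
        rw [← zpow_add₀ hc]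
        congr 1
        ring
      have hzz : z ^ (N + M) / z ^ (N - M) = z ^ (2 * M) := by
        rw [← zpow_sub₀ hz]
        congr 1
        ring
      have hs : (-1 : ℂ) ^ (N + M) * (-1) ^ (N - M) = 1 := by
        rw [← zpow_add₀ (by norm_num), show N + M + (N - M) = 2 * N by ring, hsgn]
      linear_combination
        (c ^ (N + M) * c ^ (N - M) * (z ^ (N + M) / z ^ (N - M))) * hs
          + (z ^ (N + M) / z ^ (N - M)) * hcc + c ^ (2 * N) * hzz
    linear_combination (p ^ ((N + M) * (N + M - 1) / 2) * p ^ ((N - M) * (N - M - 1) / 2)) * e3 +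
      c ^ (2 * N) * z ^ (2 * M) * e2
  · refine (((hasSum_thetaEven hp hc).mul_of_complex (hasSum_thetaOdd hp hz)).mul_left
      (-c)).congr_fun ?_
    rintro ⟨N, M⟩
    have e : (N + M + 1) * (N + M + 1 - 1) / 2 + (N - M) * (N - M - 1) / 2 =
        N ^ 2 + (M ^ 2 + M) := by
      have h1 := two_mul_triangular (N + M + 1)
      have h2 := two_mul_triangular (N - M)
      linarith [show (N + M + 1) * (N + M + 1 - 1) + (N - M) * (N - M - 1) =
        2 * (N ^ 2 + (M ^ 2 + M)) by ring]
    have e2 := congrArg (p ^ ·) e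
    simp only at e2 ⊢
    rw [zpow_add_of_nonneg p (triangularGrowth_triangular.nonneg _)
        (triangularGrowth_triangular.nonneg _),
      zpow_add_of_nonneg p (by positivity) (sq_add_self_nonneg M)] at e2
    have e3 : (-(c * z)) ^ (N + M + 1) * (-(c / z)) ^ (N - M) =
        -(c * c ^ (2 * N) * z ^ (2 * M + 1)) := by
      rw [neg_eq_neg_one_mul, neg_eq_neg_one_mul (c / z), mul_zpow, mul_zpow, mul_zpow, div_zpow]
      have hzz : z ^ (N + M + 1) / z ^ (N - M) = z ^ (2 * M + 1) := by
        rw [← zpow_sub₀ hz]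
        congr 1
        ring
      have hs : (-1 : ℂ) ^ (N + M + 1) * (-1) ^ (N - M) = -1 := by
        rw [← zpow_add₀ (by norm_num), show N + M + 1 + (N - M) = 2 * N + 1 by ring,
          zpow_add₀ (by norm_num), hsgn]
        simp
      have hcc : c ^ (N + M + 1) * c ^ (N - M) = c * c ^ (2 * N) := by
        rw [← zpow_add₀ hc, ← zpow_one_add₀ hc]
        congr 1
        ring
      linear_combination
        (c ^ (N + M + 1) * c ^ (N - M) * (z ^ (N + M + 1) / z ^ (N - M))) * hs
          - (z ^ (N + M + 1) / z ^ (N - M)) * hcc - c * c ^ (2 * N) * hzz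
    linear_combination
      (p ^ ((N + M + 1) * (N + M + 1 - 1) / 2) * p ^ ((N - M) * (N - M - 1) / 2)) * e3
      - c * c ^ (2 * N) * z ^ (2 * M + 1) * e2

/-- Weierstrass' addition formula. -/
theorem modTheta_addition {p : ℂ} (hp : ‖p‖ < 1) {x y u v : ℂ} (hx : x ≠ 0) (hy : y ≠ 0)
    (hu : u ≠ 0) (hv : v ≠ 0) :
    u / y * (modTheta (x * u) p * modTheta (x / u) p)
        * (modTheta (y * v) p * modTheta (y / v) p) =
      modTheta (x * y) p * modTheta (x / y) p * (modTheta (u * v) p * modTheta (u / v) p)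
        - modTheta (x * v) p * modTheta (x / v) p
          * (modTheta (u * y) p * modTheta (u / y) p) := by
  obtain ⟨W, -, h⟩ := modTheta_mul_modTheta_div hp
  -- What remains is the Plücker relation between the 2×2 minors of the four vectors `(E, O)` at
  -- `x`, `y`, `u`, `v`.
  rw [h x u hx hu, h y v hy hv, h x y hx hy, h u v hu hv, h x v hx hv, h u y hu hy]
  field_simp
  ring

/-- The cubic theta function and products of two theta functions satisfy an addition formula. -/
theorem cubicTheta_addition {r : ℂ} (hr : ‖r‖ < 1) {b a c z : ℂ} (hb : b ≠ 0) (ha : a ≠ 0)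
    (hc : c ≠ 0) (hz : z ≠ 0) :
    cubicTheta b z r * (modTheta (c * a) (r ^ 3) * modTheta (c / a) (r ^ 3)) =
      cubicTheta b a r * (modTheta (c * z) (r ^ 3) * modTheta (c / z) (r ^ 3))
        - c / a * cubicTheta b c r * (modTheta (a * z) (r ^ 3) * modTheta (a / z) (r ^ 3)) := by
  have hr3 : ‖r ^ 3‖ < 1 := by
    rw [norm_pow]
    exact pow_lt_one₀ (norm_nonneg r) hr (by norm_num)
  obtain ⟨W, -, h⟩ := modTheta_mul_modTheta_div hr3
  -- Cramer's rule: the vector `(E, O)` at `z` is expanded in those at `a` and `c`, and the linear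
  -- form with coefficients `thetaEven r b` and `r * thetaOdd r b` is applied.
  rw [h c a hc ha, h c z hc hz, h a z ha hz, cubicTheta_eq hr hb hz, cubicTheta_eq hr hb ha,
    cubicTheta_eq hr hb hc]
  field_simp
  ring

/-! ### Expansion of a product from an abstract three-term relation. -/

/-- The product `F i * F (i + 1) * ⋯ * F (i + m - 1)`. -/
noncomputable def shiftProd (F : ℤ → ℂ) (i : ℤ) (m : ℕ) : ℂ := ∏ j ∈ Finset.range m, F (i + j)

theorem shiftProd_zero (F : ℤ → ℂ) (i : ℤ) : shiftProd F i 0 = 1 := rfl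

theorem shiftProd_succ_right (F : ℤ → ℂ) {i j : ℤ} {m m' : ℕ} (hm : m' = m + 1) (h : j = i + m) :
    shiftProd F i m' = shiftProd F i m * F j := by
  subst h hm
  exact Finset.prod_range_succ _ _

theorem shiftProd_succ_left (F : ℤ → ℂ) {i j : ℤ} {m m' : ℕ} (hm : m' = m + 1) (h : j = i + 1) :
    shiftProd F i m' = F i * shiftProd F j m := by
  subst h hm
  rw [shiftProd, Finset.prod_range_succ', mul_comm, shiftProd]
  congr 1
  · simp
  · refine Finset.prod_congr rfl fun k _ => ?_
    push_cast
    congr 1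
    ring

/-- The coefficients in the expansion of `∏ j, g (y q ^ j)` for a function `g` subject to a
three-term relation. -/
noncomputable def expansionCoeff (U V W X Y Z Q : ℤ → ℂ) (q σ : ℂ) (e : ℤ) (k l : ℕ) : ℂ :=
  (σ * q ^ (1 - e)) ^ k * (Y (2 * k - 1 + e) / shiftProd Y (k - 1 + e) (k + l + 1))
    * shiftProd U (k + l - 1 + e) k * shiftProd V e k * shiftProd W k l
    * shiftProd X (1 - l) l * shiftProd Q (-(k + l)) k / shiftProd Q 1 k
    / shiftProd Z (1 - k - l - e) (k + l)

section

variable {U V W X Y Z Q : ℤ → ℂ} {q σ : ℂ}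

/-- Left edge of the recurrence: a term without `Gκ` factors arises only by choosing `Gα` at every
step. -/
theorem expansionCoeff_zero_succ (hY : ∀ j, Y j ≠ 0) (e : ℤ) (n : ℕ) :
    expansionCoeff U V W X Y Z Q q σ e 0 (n + 1) =
      expansionCoeff U V W X Y Z Q q σ (e + 1) 0 n
        * (W n * X (-n) / (Y e * Z (-e))) := by
  unfold expansionCoeff
  rw [shiftProd_succ_right W (j := n) rfl (by push_cast; ring),
    shiftProd_succ_left X (i := 1 - (n + 1 : ℕ)) (j := 1 - n) rfl (by push_cast; ring),
    shiftProd_succ_left Y (i := ((0 : ℕ) : ℤ) - 1 + e) (m := n + 1) (j := e) (by ring)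
      (by push_cast; ring),
    shiftProd_succ_right Z (m := n) (j := -e) (by ring) (by push_cast; ring)]
  have h1 := hY e
  have h2 := hY (-1 + e)
  simp only [shiftProd_zero, pow_zero]
  rw [show 1 - ((n + 1 : ℕ) : ℤ) = -n by push_cast; ring,
    show 2 * ((0 : ℕ) : ℤ) - 1 + e = -1 + e by push_cast; ring,
    show ((0 : ℕ) : ℤ) - 1 + e = -1 + e by push_cast; ring,
    show 2 * ((0 : ℕ) : ℤ) - 1 + (e + 1) = e by push_cast; ring,
    show ((0 : ℕ) : ℤ) - 1 + (e + 1) = e by push_cast; ring,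
    show 1 - ((0 : ℕ) : ℤ) - ((n + 1 : ℕ) : ℤ) - e = -n - e by push_cast; ring,
    show 1 - ((0 : ℕ) : ℤ) - (n : ℤ) - (e + 1) = -n - e by push_cast; ring,
    show 0 + n + 1 = n + 1 by ring, show 0 + n = n by ring]
  field_simp

/-- Right edge: `Gκ` is chosen at every step. The quotient of `Q`-blocks gains `Q (-(n + 1)) / Q (n
+ 1)`, which the reflection `hQ'` turns into a sign and a power of `q`. -/
theorem expansionCoeff_succ_zero (hq : q ≠ 0) (hY : ∀ j, Y j ≠ 0) (e : ℤ) (n : ℕ)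
    (hQ : shiftProd Q 1 (n + 1) ≠ 0)
    (hQ' : Q (-(n + 1)) = -(Q (n + 1) / q ^ (n + 1))) :
    expansionCoeff U V W X Y Z Q q σ e (n + 1) 0 =
      expansionCoeff U V W X Y Z Q q σ (e + 1) n 0
        * (-(σ * q ^ (-e) * (U (2 * n + e) * V e)) / (Y (2 * n + e) * Z (-e))) := by
  unfold expansionCoeff
  rw [shiftProd_succ_right Q (m := n) (i := 1) (j := n + 1) rfl (by ring)] at hQ ⊢
  have hQ1 := left_ne_zero_of_mul hQ
  have hQ2 := right_ne_zero_of_mul hQ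
  rw [shiftProd_succ_right U (m := n) (j := 2 * n + e) rfl (by push_cast; ring),
    shiftProd_succ_left V (m := n) (j := e + 1) rfl rfl,
    shiftProd_succ_left Q (m := n) (j := -n) rfl (by push_cast; ring),
    shiftProd_succ_right Y (m := n + 1) (j := 2 * n + 1 + e) rfl (by push_cast; ring),
    shiftProd_succ_right Z (m := n) (j := -e) rfl (by push_cast; ring)]
  have h1 := hY (2 * n + e)
  have h2 := hY (2 * n + 1 + e)
  have h3 : q ^ (1 - e) = q * q ^ (-e) := by rw [sub_eq_add_neg, zpow_add₀ hq, zpow_one]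
  simp only [shiftProd_zero]
  push_cast
  rw [show (n : ℤ) + 1 + 0 - 1 + e = n + 0 - 1 + (e + 1) by ring,
    show -((n : ℤ) + 1 + 0) = -(n + 1) by ring, hQ', show -((n : ℤ) + 0) = -n by ring,
    show (n : ℤ) + 1 - 1 + e = n - 1 + (e + 1) by ring,
    show 2 * ((n : ℤ) + 1) - 1 + e = 2 * n + 1 + e by ring,
    show 2 * (n : ℤ) - 1 + (e + 1) = 2 * n + e by ring,
    show 1 - ((n : ℤ) + 1) - 0 - e = 1 - n - 0 - (e + 1) by ring,
    show 1 - (e + 1) = -e by ring, h3]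
  simp only [add_zero]
  field_simp
  ring

/-- Interior of the recurrence: the last choice was `Gα` or `Gκ`. Once the common blocks are
removed, exactly the relation `H` is left, and Weierstrass' formula will supply it. -/
theorem expansionCoeff_succ_succ (hq : q ≠ 0) (hY : ∀ j, Y j ≠ 0) (e : ℤ) (k l : ℕ)
    (hQ : shiftProd Q 1 (k + 1) ≠ 0)
    (H : q ^ (k + 1) * Y (2 * k + 1 + e) * V e * W (k + l + 1) * Q (-(k + l + 2)) =
      V (k + 1 + e) * W (2 * k + l + 2) * Q (-(l + 1)) * Y (k + e)
        - W k * V (-(l + 1) + e) * Q (k + 1) * Y (2 * k + l + 2 + e)) :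
    expansionCoeff U V W X Y Z Q q σ e (k + 1) (l + 1) =
      expansionCoeff U V W X Y Z Q q σ (e + 1) (k + 1) l
        * (W (2 * k + l + 2) * X (-l) / (Y (2 * k + 2 + e) * Z (-e)))
      + expansionCoeff U V W X Y Z Q q σ (e + 1) k (l + 1)
        * (-(σ * q ^ (-e) * (U (2 * k + l + 1 + e) * V (-(l + 1) + e)))
          / (Y (2 * k + e) * Z (-e))) := by
  unfold expansionCoeff
  rw [shiftProd_succ_right Q (m := k) (i := 1) (j := k + 1) rfl (by ring)] at hQ ⊢
  have hQ1 := left_ne_zero_of_mul hQ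
  have hQ2 := right_ne_zero_of_mul hQ
  push_cast
  rw [show (k : ℤ) + 1 + (l + 1) - 1 + e = k + l + 1 + e by ring,
    show (k : ℤ) + 1 + l - 1 + (e + 1) = k + l + 1 + e by ring,
    show (k : ℤ) + (l + 1) - 1 + (e + 1) = k + l + 1 + e by ring,
    show (k : ℤ) + 1 - 1 + e = k + e by ring,
    show (k : ℤ) + 1 - 1 + (e + 1) = k + 1 + e by ring,
    show (k : ℤ) - 1 + (e + 1) = k + e by ring,
    show 1 - ((l : ℤ) + 1) = -l by ring,
    show -((k : ℤ) + 1 + (l + 1)) = -(k + l + 2) by ring,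
    show -((k : ℤ) + 1 + l) = -(k + l + 1) by ring,
    show -((k : ℤ) + (l + 1)) = -(k + l + 1) by ring,
    show 1 - ((k : ℤ) + 1) - (l + 1) - e = -(k + l + 1) - e by ring,
    show 1 - ((k : ℤ) + 1) - l - (e + 1) = -(k + l + 1) - e by ring,
    show 1 - (k : ℤ) - (l + 1) - (e + 1) = -(k + l + 1) - e by ring,
    show 2 * ((k : ℤ) + 1) - 1 + e = 2 * k + 1 + e by ring,
    show 2 * ((k : ℤ) + 1) - 1 + (e + 1) = 2 * k + 2 + e by ring,
    show 2 * (k : ℤ) - 1 + (e + 1) = 2 * k + e by ring,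
    show 1 - (e + 1) = -e by ring,
    shiftProd_succ_right U (m := k) (j := 2 * k + l + 1 + e) rfl (by ring),
    shiftProd_succ_left V (i := e) (m := k) (j := e + 1) rfl rfl,
    shiftProd_succ_right V (i := e + 1) (m := k) (j := k + 1 + e) rfl (by ring),
    shiftProd_succ_right W (i := k + 1) (m := l) (j := k + l + 1) rfl (by ring),
    shiftProd_succ_left W (i := k) (m := l) (j := k + 1) rfl rfl,
    shiftProd_succ_left X (i := -l) (m := l) (j := 1 - l) rfl (by ring),
    shiftProd_succ_left Q (i := -(k + l + 2)) (m := k) (j := -(k + l + 1)) rfl (by ring),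
    shiftProd_succ_right Q (i := -(k + l + 1)) (m := k) (j := -(l + 1)) rfl (by ring),
    shiftProd_succ_left Y (i := k + e) (m := k + l + 2) (m' := k + 1 + (l + 1) + 1)
      (j := k + 1 + e) (by ring) (by ring),
    shiftProd_succ_left Y (i := k + e) (m := k + l + 1) (m' := k + (l + 1) + 1)
      (j := k + 1 + e) (by ring) (by ring),
    shiftProd_succ_right Y (i := k + 1 + e) (m := k + l + 1) (m' := k + l + 2)
      (j := 2 * k + l + 2 + e) (by ring) (by push_cast; ring),
    shiftProd_succ_right Y (i := k + 1 + e) (m := k + l + 1) (m' := k + 1 + l + 1)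
      (j := 2 * k + l + 2 + e) (by ring) (by push_cast; ring),
    shiftProd_succ_right Z (m := k + l + 1) (m' := k + 1 + (l + 1)) (j := -e) (by ring)
      (by push_cast; ring),
    show k + 1 + l = k + l + 1 by ring, show k + (l + 1) = k + l + 1 by ring]
  have h1 := hY (2 * k + e)
  have h2 := hY (2 * k + 2 + e)
  have h4 := hY (k + e)
  have h5 := hY (2 * k + l + 2 + e)
  have h3 : q ^ (1 - e) = q * q ^ (-e) := by rw [sub_eq_add_neg, zpow_add₀ hq, zpow_one]
  rw [h3]
  field_simp
  linear_combination (σ ^ (k + 1) * (q ^ (-e)) ^ (k + 1) * shiftProd U (k + l + 1 + e) k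
    * U (2 * k + l + 1 + e) * shiftProd V (e + 1) k * shiftProd W (k + 1) l * X (-l)
    * shiftProd X (1 - l) l * shiftProd Q (-(k + l + 1)) k
    / (shiftProd Y (k + 1 + e) (k + l + 1) * shiftProd Z (-(k + l + 1) - e) (k + l + 1)
      * Z (-e))) * H

/-- The rearrangement behind Pascal's rule: each term on the right feeds the positions `k` and `k +
1`. -/
theorem sum_eq_sum_of_two_term {c a b G : ℕ → ℂ} {n : ℕ} (h0 : c 0 = a 0) (hn : c (n + 1) = b n)
    (h : ∀ k < n, c (k + 1) = a (k + 1) + b k) :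
    ∑ k ∈ Finset.range (n + 2), c k * G k =
      ∑ k ∈ Finset.range (n + 1), (a k * G k + b k * G (k + 1)) := by
  rw [Finset.sum_add_distrib, Finset.sum_range_succ, Finset.sum_range_succ',
    Finset.sum_range_succ' (fun k => a k * G k), Finset.sum_range_succ (fun k => b k * G (k + 1)),
    h0, hn, Finset.sum_congr rfl fun k hk => by
      rw [h k (Finset.mem_range.mp hk), add_mul], Finset.sum_add_distrib]
  ring

/-- Expansion of `Gy 0 * ⋯ * Gy (n - 1)` from a three-term relation between the values of a
function at the points of three geometric progressions. -/
theorem shiftProd_eq_sum {Gy Gα Gκ : ℤ → ℂ} (hq : q ≠ 0) (hY : ∀ j, Y j ≠ 0) (hZ : ∀ j, Z j ≠ 0)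
    (hG : ∀ n k i : ℤ, Gy n * (Y (k + i) * Z (k - i)) =
      Gα i * (W (n + k) * X (k - n)) - σ * q ^ (k - i) * Gκ k * (U (i + n) * V (i - n)))
    (hQ' : ∀ m : ℕ, Q (-m) = -(Q m / q ^ m))
    (H : ∀ (n k : ℕ) (e : ℤ), q ^ k * Y (2 * k - 1 + e) * V e * W n * Q (-(n + 1)) =
      V (k + e) * W (n + k) * Q (k - 1 - n) * Y (k - 1 + e)
        - W (k - 1) * V (k - 1 - n + e) * Q k * Y (k + n + e))
    (n : ℕ) (hQ : shiftProd Q 1 n ≠ 0) (e : ℤ) :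
    shiftProd Gy 0 n = ∑ k ∈ Finset.range (n + 1),
      expansionCoeff U V W X Y Z Q q σ e k (n - k)
        * (shiftProd Gκ 0 k * shiftProd Gα (k + e) (n - k)) := by
  induction n generalizing e with
  | zero => simp [expansionCoeff, shiftProd, hY]
  | succ n ih =>
    have hQm : ∀ m ≤ n + 1, shiftProd Q 1 m ≠ 0 := fun m hm => by
      unfold shiftProd at hQ ⊢
      rw [Finset.prod_ne_zero_iff] at hQ ⊢
      exact fun j hj => hQ j (Finset.mem_range.mpr ((Finset.mem_range.mp hj).trans_le hm))
    rw [sum_eq_sum_of_two_term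
      (a := fun k => expansionCoeff U V W X Y Z Q q σ (e + 1) k (n - k)
        * (W (n + k) * X (k - n) / (Y (2 * k + e) * Z (-e))))
      (b := fun k => expansionCoeff U V W X Y Z Q q σ (e + 1) k (n - k)
        * (-(σ * q ^ (-e) * (U (n + k + e) * V (k - n + e))) / (Y (2 * k + e) * Z (-e))))]
    · rw [shiftProd_succ_right Gy (m := n) (j := n) rfl (by ring), ih (hQm n (by omega)) (e + 1),
        Finset.sum_mul]
      refine Finset.sum_congr rfl fun k hk => ?_
      obtain ⟨l, rfl⟩ := Nat.exists_eq_add_of_le (Nat.lt_succ_iff.mp (Finset.mem_range.mp hk))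
      -- With `i = k + e`, the value `Gα i` extends the `α`-block on its left and `Gκ k` extends the
      -- `κ`-block on its right. Moreover the factor `Z (k - i) = Z (-e)` does not depend on `k`.
      have hg := hG (k + l : ℕ) k (k + e)
      rw [shiftProd_succ_left Gα (i := k + e) (j := k + (e + 1)) (m := k + l - k) (by omega)
          (by ring),
        shiftProd_succ_right Gκ (m := k) (j := k) rfl (by ring),
        show k + l + 1 - (k + 1) = k + l - k by omega]
      rw [show (k : ℤ) + (k + e) = 2 * k + e by ring, show (k : ℤ) - (k + e) = -e by ring,
        show (k : ℤ) + e + (k + l : ℕ) = (k + l : ℕ) + k + e by ring,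
        show (k : ℤ) + e - (k + l : ℕ) = k - (k + l : ℕ) + e by ring] at hg
      have h1 := hY (2 * k + e)
      have h2 := hZ (-e)
      rw [show ((k + 1 : ℕ) : ℤ) + e = k + (e + 1) by push_cast; ring]
      field_simp
      linear_combination (shiftProd Gκ 0 k * shiftProd Gα (k + (e + 1)) (k + l - k)
        * expansionCoeff U V W X Y Z Q q σ (e + 1) k (k + l - k)) * hg
    · have := expansionCoeff_zero_succ (U := U) (V := V) (W := W) (X := X) (Z := Z) (Q := Q)
        (q := q) (σ := σ) hY e n
      simpa using this
    · have := expansionCoeff_succ_zero (U := U) (V := V) (W := W) (X := X) (Z := Z) (σ := σ)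
        hq hY e n hQ (by exact_mod_cast hQ' (n + 1))
      simp only [Nat.sub_self]
      rw [this, show (n : ℤ) + n + e = 2 * n + e by ring, show (n : ℤ) - n + e = e by ring]
    · intro k hk
      obtain ⟨l, rfl⟩ := Nat.exists_eq_add_of_le hk
      have hH := H (k + l + 1) (k + 1) e
      push_cast at hH
      rw [show 2 * ((k : ℤ) + 1) - 1 + e = 2 * k + 1 + e by ring,
        show (k : ℤ) + l + 1 + 1 = k + l + 2 by ring,
        show (k : ℤ) + l + 1 + (k + 1) = 2 * k + l + 2 by ring,
        show (k : ℤ) + 1 - 1 - (k + l + 1) = -(l + 1) by ring,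
        show (k : ℤ) + 1 - 1 = k by ring,
        show (k : ℤ) + 1 + (k + l + 1) + e = 2 * k + l + 2 + e by ring] at hH
      have := expansionCoeff_succ_succ (U := U) (V := V) (W := W) (X := X) (Z := Z) (Q := Q)
        (σ := σ) hq hY e k l (hQm (k + 1) (by omega)) hH
      rw [show k.succ + l + 1 - (k + 1) = l + 1 by omega,
        show k.succ + l - (k + 1) = l by omega, show k.succ + l - k = l + 1 by omega, this]
      push_cast
      rw [show (k : ℤ) + 1 + l + (k + 1) = 2 * k + l + 2 by ring,
        show (k : ℤ) + 1 - (k + 1 + l) = -l by ring,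
        show 2 * ((k : ℤ) + 1) + e = 2 * k + 2 + e by ring,
        show (k : ℤ) + 1 + l + k + e = 2 * k + l + 1 + e by ring,
        show (k : ℤ) - (k + 1 + l) + e = -(l + 1) + e by ring]

end

/-! ### Specialisation to theta functions. -/

/-- The first argument of `γ` is constant within a factorial. Isolating it as `β` allows factorials
of different lengths to be compared with blocks of one function `γ(β, ·)`. -/
theorem cubicPoch_eq_shiftProd {A B x y s r β y₀ : ℂ} {m : ℕ} {i : ℤ} (hs : s ≠ 0) (hx : x ≠ 0)
    (hy : y ≠ 0) (hA : A = x * y) (hB : B = x / y) (hβ : β = x * s ^ ((m : ℤ) - 1))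
    (h₀ : y₀ * (s ^ 2) ^ i = y * s ^ (1 - (m : ℤ))) :
    cubicPoch A B (s ^ 2) r m =
      shiftProd (fun j => cubicTheta β (y₀ * (s ^ 2) ^ j) r) i m := by
  subst hA hB hβ
  rw [cubicPoch_mul_div x y s r hx hy]
  refine Finset.prod_congr rfl fun j _ => ?_
  simp only [← h₀, zpow_add₀ (pow_ne_zero 2 hs), zpow_natCast, mul_assoc]

theorem shiftProd_eq_thetaPoch {F : ℤ → ℂ} {x q p : ℂ} {i : ℤ} {m : ℕ}
    (h : ∀ j : ℕ, F (i + j) = modTheta (x * q ^ j) p) : shiftProd F i m = thetaPoch x q p m :=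
  Finset.prod_congr rfl fun j _ => h j

theorem thetaPoch_add (x q p : ℂ) (k l : ℕ) :
    thetaPoch x q p (k + l) = thetaPoch x q p k * thetaPoch (x * q ^ k) q p l := by
  simp only [thetaPoch, Finset.prod_range_add, pow_add, mul_assoc]

theorem thetaPoch_one (x q p : ℂ) : thetaPoch x q p 1 = modTheta x p := by
  simp [thetaPoch]

theorem thetaPoch_ne_zero_of_le {x q p : ℂ} {k n : ℕ} (hk : k ≤ n) (h : thetaPoch x q p n ≠ 0) :
    thetaPoch x q p k ≠ 0 := by
  obtain ⟨l, rfl⟩ := Nat.exists_eq_add_of_le hk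
  rw [thetaPoch_add] at h
  exact left_ne_zero_of_mul h

theorem thetaPoch_ne_zero {x q p : ℂ} (h : ∀ j : ℤ, modTheta (x * q ^ j) p ≠ 0) (n : ℕ) :
    thetaPoch x q p n ≠ 0 :=
  Finset.prod_ne_zero_iff.mpr fun j _ => by exact_mod_cast h j

/-- The expansion of a product of cubic theta functions, for generic parameters. -/
theorem shiftProd_cubicTheta_eq_sum {r q α κ y β : ℂ} (hr : ‖r‖ < 1) (hq : q ≠ 0) (hα : α ≠ 0)
    (hκ : κ ≠ 0) (hy : y ≠ 0) (hβ : β ≠ 0)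
    (hY : ∀ j : ℤ, modTheta (α * κ * q ^ j) (r ^ 3) ≠ 0)
    (hZ : ∀ j : ℤ, modTheta (κ / α * q ^ j) (r ^ 3) ≠ 0) (n : ℕ)
    (hQ : thetaPoch q q (r ^ 3) n ≠ 0) :
    shiftProd (fun j => cubicTheta β (y * q ^ j) r) 0 n = ∑ k ∈ Finset.range (n + 1),
      expansionCoeff (fun j => modTheta (α * y * q ^ j) (r ^ 3))
          (fun j => modTheta (α / y * q ^ j) (r ^ 3)) (fun j => modTheta (κ * y * q ^ j) (r ^ 3))
          (fun j => modTheta (κ / y * q ^ j) (r ^ 3)) (fun j => modTheta (α * κ * q ^ j) (r ^ 3))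
          (fun j => modTheta (κ / α * q ^ j) (r ^ 3)) (fun j => modTheta (q ^ j) (r ^ 3))
          q (κ / α) 0 k (n - k)
        * (shiftProd (fun j => cubicTheta β (κ * q ^ j) r) 0 k
          * shiftProd (fun j => cubicTheta β (α * q ^ j) r) k (n - k)) := by
  have hr3 : ‖r ^ 3‖ < 1 := by
    rw [norm_pow]
    exact pow_lt_one₀ (norm_nonneg r) hr (by norm_num)
  have hz : ∀ j : ℤ, q ^ j ≠ 0 := fun j => zpow_ne_zero j hq
  have hQ' : shiftProd (fun j => modTheta (q ^ j) (r ^ 3)) 1 n ≠ 0 := by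
    rwa [shiftProd_eq_thetaPoch (x := q) (q := q) fun j => by
      rw [zpow_add₀ hq, zpow_one, zpow_natCast]]
  have key := shiftProd_eq_sum (q := q) (σ := κ / α)
    (U := fun j => modTheta (α * y * q ^ j) (r ^ 3))
    (V := fun j => modTheta (α / y * q ^ j) (r ^ 3))
    (W := fun j => modTheta (κ * y * q ^ j) (r ^ 3))
    (X := fun j => modTheta (κ / y * q ^ j) (r ^ 3))
    (Y := fun j => modTheta (α * κ * q ^ j) (r ^ 3))
    (Z := fun j => modTheta (κ / α * q ^ j) (r ^ 3))
    (Q := fun j => modTheta (q ^ j) (r ^ 3))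
    (Gy := fun j => cubicTheta β (y * q ^ j) r) (Gα := fun j => cubicTheta β (α * q ^ j) r)
    (Gκ := fun j => cubicTheta β (κ * q ^ j) r) hq hY hZ ?_ ?_ ?_ n hQ' 0
  · simpa using key
  · intro m k i
    have h := cubicTheta_addition hr hβ (mul_ne_zero hα (hz i)) (mul_ne_zero hκ (hz k))
      (mul_ne_zero hy (hz m))
    have e1 : κ * q ^ k * (α * q ^ i) = α * κ * q ^ (k + i) := by rw [zpow_add₀ hq]; ring
    have e2 : κ * q ^ k / (α * q ^ i) = κ / α * q ^ (k - i) := by rw [zpow_sub₀ hq]; field_simp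
    have e3 : κ * q ^ k * (y * q ^ m) = κ * y * q ^ (m + k) := by rw [zpow_add₀ hq]; ring
    have e4 : κ * q ^ k / (y * q ^ m) = κ / y * q ^ (k - m) := by rw [zpow_sub₀ hq]; field_simp
    have e5 : α * q ^ i * (y * q ^ m) = α * y * q ^ (i + m) := by rw [zpow_add₀ hq]; ring
    have e6 : α * q ^ i / (y * q ^ m) = α / y * q ^ (i - m) := by rw [zpow_sub₀ hq]; field_simp
    rw [e1, e2, e3, e4, e5, e6] at h
    exact h
  · intro m
    have h := modTheta_inv hr3 (hz m)
    simp only [zpow_neg]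
    simpa using h
  · intro m k e
    -- Weierstrass' formula is applied at `μ q^(k-1-m)`, `μ`, `μ q^k` and `κ y q^m / μ`. Since `μ² =
    -- α κ q^(e+m)`, products of two of the first three arguments have the form `α κ q^j` and their
    -- quotients are powers of `q`; with the fourth, products have the form `κ y q^j` and quotients
    -- `α / y q^j`.
    obtain ⟨μ, hμ⟩ := IsAlgClosed.exists_pow_nat_eq (α * κ * q ^ (e + m)) (n := 2) two_pos
    have hμ0 : μ ≠ 0 := by
      rintro rfl
      have : α * κ * q ^ (e + m) ≠ 0 := mul_ne_zero (mul_ne_zero hα hκ) (hz _)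
      exact this (by rw [← hμ]; ring)
    have h := modTheta_addition hr3 (mul_ne_zero hμ0 (hz (k - 1 - m))) hμ0
      (mul_ne_zero hμ0 (hz k))
      (div_ne_zero (mul_ne_zero (mul_ne_zero hκ hy) (hz m)) hμ0)
    have e1 : μ * q ^ ((k : ℤ) - 1 - m) * (μ * q ^ (k : ℤ)) = α * κ * q ^ (2 * (k : ℤ) - 1 + e) := by
      rw [mul_mul_mul_comm, ← sq, hμ, mul_assoc, ← zpow_add₀ hq, ← zpow_add₀ hq]
      congr 2; ring
    have e2 : μ * q ^ ((k : ℤ) - 1 - m) / (μ * q ^ (k : ℤ)) = q ^ (-((m : ℤ) + 1)) := by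
      rw [mul_div_mul_left _ _ hμ0, ← zpow_sub₀ hq]
      congr 1; ring
    have e3 : μ * (κ * y * q ^ (m : ℤ) / μ) = κ * y * q ^ (m : ℤ) := by field_simp
    have e4 : μ / (κ * y * q ^ (m : ℤ) / μ) = α / y * q ^ e := by
      rw [zpow_add₀ hq] at hμ
      have := hz m
      field_simp
      rw [hμ]; ring
    have e5 : μ * q ^ ((k : ℤ) - 1 - m) * μ = α * κ * q ^ ((k : ℤ) - 1 + e) := by
      rw [mul_right_comm, ← sq, hμ, mul_assoc, ← zpow_add₀ hq]
      congr 2; ring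
    have e6 : μ * q ^ ((k : ℤ) - 1 - m) / μ = q ^ ((k : ℤ) - 1 - m) := by field_simp
    have e7 : μ * q ^ (k : ℤ) * (κ * y * q ^ (m : ℤ) / μ) = κ * y * q ^ ((m : ℤ) + k) := by
      rw [zpow_add₀ hq]; field_simp
    have e8 : μ * q ^ (k : ℤ) / (κ * y * q ^ (m : ℤ) / μ) = α / y * q ^ ((k : ℤ) + e) := by
      rw [zpow_add₀ hq, mul_comm μ, mul_div_assoc, e4]; ring
    have e9 : μ * q ^ ((k : ℤ) - 1 - m) * (κ * y * q ^ (m : ℤ) / μ) = κ * y * q ^ ((k : ℤ) - 1) := by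
      rw [zpow_sub₀ hq _ (m : ℤ)]
      have := hz m
      field_simp
    have e10 : μ * q ^ ((k : ℤ) - 1 - m) / (κ * y * q ^ (m : ℤ) / μ) =
        α / y * q ^ ((k : ℤ) - 1 - m + e) := by
      rw [zpow_add₀ hq, mul_comm μ, mul_div_assoc, e4]; ring
    have e11 : μ * q ^ (k : ℤ) * μ = α * κ * q ^ ((k : ℤ) + m + e) := by
      rw [mul_right_comm, ← sq, hμ, mul_assoc, ← zpow_add₀ hq]
      congr 2; ring
    have e12 : μ * q ^ (k : ℤ) / μ = q ^ (k : ℤ) := by field_simp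
    rw [e1, e2, e3, e4, e5, e6, e7, e8, e9, e10, e11, e12] at h
    rw [← zpow_natCast q k]
    linear_combination h

-- The half-integral powers of `q` cancel in `α κ = a c`, `κ y = c z` and `α / y = a / z`; in `α y`,
-- `κ / y` and `κ / α` they combine to integral powers `q^(±(N-1))`.
set_option maxHeartbeats 1000000 in
theorem expansionCoeff_eq_thetaPoch {p q s a c z : ℂ} {k l : ℕ} (hs : s ≠ 0) (hsq : s ^ 2 = q)
    (ha : a ≠ 0) (hc : c ≠ 0) (hz : z ≠ 0)
    (hY : ∀ j : ℤ, modTheta (a * c * q ^ j) p ≠ 0) (hZ : ∀ j : ℤ, modTheta (c / a * q ^ j) p ≠ 0)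
    (hW : ∀ j : ℤ, modTheta (c * z * q ^ j) p ≠ 0) (hX : ∀ j : ℤ, modTheta (c / z * q ^ j) p ≠ 0)
    {α κ y : ℂ} (hα : α = a * s ^ (1 - ((k + l : ℕ) : ℤ))) (hκ : κ = c * s ^ (((k + l : ℕ) : ℤ) - 1))
    (hy : y = z * s ^ (1 - ((k + l : ℕ) : ℤ))) :
    expansionCoeff (fun j => modTheta (α * y * q ^ j) p) (fun j => modTheta (α / y * q ^ j) p)
        (fun j => modTheta (κ * y * q ^ j) p) (fun j => modTheta (κ / y * q ^ j) p)
        (fun j => modTheta (α * κ * q ^ j) p) (fun j => modTheta (κ / α * q ^ j) p)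
        (fun j => modTheta (q ^ j) p) q (κ / α) 0 k l
      / thetaPochs [c * z, c / z] q p (k + l) * thetaPochs [a * c, c / a] q p (k + l) =
    q ^ ((k + l) * k) * (c / a) ^ k
      * (modTheta (a * c * q ^ (2 * (k : ℤ) - 1)) p / modTheta (a * c * q⁻¹) p)
      * (thetaPochs [q ^ (-((k + l : ℕ) : ℤ)), a * c * q⁻¹, a * z, a / z] q p k
          / thetaPochs [q, a * c * q ^ (k + l), c * z, c / z] q p k) := by
  have hq : q ≠ 0 := hsq ▸ pow_ne_zero 2 hs
  have hsn : ∀ j : ℤ, s ^ j ≠ 0 := fun j => zpow_ne_zero j hs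
  have hq2 : ∀ j : ℤ, q ^ j = s ^ j * s ^ j := fun j => by
    rw [← hsq, ← zpow_ofNat, ← zpow_mul, two_mul, zpow_add₀ hs]
  set N : ℤ := ((k + l : ℕ) : ℤ) with hN
  have hinv : s ^ (1 - N) * s ^ (N - 1) = 1 := by
    rw [← zpow_add₀ hs, show 1 - N + (N - 1) = 0 by ring, zpow_zero]
  have hs1 : s ^ (1 - N) = (s ^ (N - 1))⁻¹ := eq_inv_of_mul_eq_one_left hinv
  have eU : α * y = a * z * q ^ (1 - N) := by rw [hα, hy, hq2]; ring
  have eV : α / y = a / z := by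
    rw [hα, hy]
    exact mul_div_mul_right _ _ (hsn _)
  have eW : κ * y = c * z := by rw [hκ, hy]; linear_combination c * z * hinv
  have eX : κ / y = c / z * q ^ (N - 1) := by
    rw [hκ, hy, hq2, hs1]
    have := hsn (N - 1)
    field_simp
  have eY : α * κ = a * c := by rw [hα, hκ]; linear_combination a * c * hinv
  have eZ : κ / α = c / a * q ^ (N - 1) := by
    rw [hκ, hα, hq2, hs1]
    have := hsn (N - 1)
    field_simp
  have hadd : ∀ (x : ℂ) (i j : ℤ), x * q ^ i * q ^ j = x * q ^ (i + j) := fun x i j => by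
    rw [zpow_add₀ hq, mul_assoc]
  unfold expansionCoeff
  rw [eU, eV, eW, eX, eY, eZ]
  simp only [hadd]
  rw [shiftProd_eq_thetaPoch (F := fun j => modTheta (a * z * q ^ (1 - N + j)) p) (x := a * z)
      (q := q) (fun j => by
        rw [← zpow_natCast]; congr 3; push_cast [hN]; ring),
    shiftProd_eq_thetaPoch (F := fun j => modTheta (a / z * q ^ j) p) (x := a / z)
      (q := q) (fun j => by
        rw [← zpow_natCast]; congr 3; ring),
    shiftProd_eq_thetaPoch (F := fun j => modTheta (c * z * q ^ j) p) (x := c * z * q ^ k)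
      (q := q) (fun j => by
        rw [← zpow_natCast, ← zpow_natCast, hadd]),
    shiftProd_eq_thetaPoch (F := fun j => modTheta (c / z * q ^ (N - 1 + j)) p)
      (x := c / z * q ^ k) (q := q) (fun j => by
        rw [← zpow_natCast, ← zpow_natCast, hadd]; congr 3; push_cast [hN]; ring),
    shiftProd_eq_thetaPoch (F := fun j => modTheta (q ^ j) p) (i := -((k : ℤ) + l))
      (x := q ^ (-N)) (q := q) (fun j => by
        rw [← zpow_natCast, ← zpow_add₀ hq]; congr 3),
    shiftProd_eq_thetaPoch (F := fun j => modTheta (q ^ j) p) (i := 1)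
      (x := q) (q := q) (fun j => by
        rw [← zpow_natCast, zpow_add₀ hq, zpow_one]),
    shiftProd_eq_thetaPoch (F := fun j => modTheta (c / a * q ^ (N - 1 + j)) p)
      (x := c / a) (q := q) (fun j => by
        rw [← zpow_natCast]; congr 3; push_cast [hN]; ring),
    shiftProd_eq_thetaPoch (F := fun j => modTheta (a * c * q ^ j) p)
      (x := a * c * q⁻¹ * q ^ k) (q := q) (fun j => by
        rw [← zpow_natCast, ← zpow_natCast, ← zpow_neg_one, hadd, hadd]; congr 3; ring)]
  simp only [thetaPochs, List.map_cons, List.map_nil, List.prod_cons, List.prod_nil, mul_one]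
  -- Both sides split `(a c / q; q, p)_{2k+l+1}`, at different places. This produces the
  -- very-well-poised factor and the denominator `(a c q^n; q, p)_k`.
  have hshift : thetaPoch (a * c * q⁻¹) q p k * thetaPoch (a * c * q⁻¹ * q ^ k) q p (k + l + 1) =
      modTheta (a * c * q⁻¹) p * (thetaPoch (a * c) q p (k + l)
        * thetaPoch (a * c * q ^ (k + l)) q p k) := by
    rw [← thetaPoch_add, ← thetaPoch_add, show k + (k + l + 1) = 1 + (k + l + k) by ring,
      thetaPoch_add, thetaPoch_one, pow_one, inv_mul_cancel_right₀ hq]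
  have hYi : ∀ (i : ℤ) (x : ℂ) (m : ℕ), x = a * c * q ^ i → thetaPoch x q p m ≠ 0 := by
    rintro i x m rfl
    exact thetaPoch_ne_zero (fun j => by rw [hadd]; exact hY _) m
  have n1 := hYi (-1 + k) (a * c * q⁻¹ * q ^ k) (k + l + 1) (by
    rw [← zpow_natCast, ← zpow_neg_one, hadd])
  have n2 := hYi (k + l) (a * c * q ^ (k + l)) k (by
    exact_mod_cast rfl)
  have n3 : modTheta (a * c * q⁻¹) p ≠ 0 := by simpa using hY (-1)
  have n4 := thetaPoch_ne_zero hZ (k + l)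
  rw [thetaPoch_add (c * z), thetaPoch_add (c / z)]
  have m1 := thetaPoch_ne_zero hW (k + l)
  have m2 := thetaPoch_ne_zero hX (k + l)
  rw [thetaPoch_add] at m1 m2
  have m3 := left_ne_zero_of_mul m1
  have m4 := right_ne_zero_of_mul m1
  have m5 := left_ne_zero_of_mul m2
  have m6 := right_ne_zero_of_mul m2
  have hpow : (c / a * q ^ (N - 1 + (1 - (0 : ℤ)))) ^ k = q ^ ((k + l) * k) * (c / a) ^ k := by
    rw [show N - 1 + (1 - 0) = N by ring, hN, zpow_natCast, mul_pow, ← pow_mul]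
    ring
  have hac : thetaPoch (a * c) q p (k + l) = thetaPoch (a * c * q⁻¹) q p k
      * thetaPoch (a * c * q⁻¹ * q ^ k) q p (k + l + 1)
        / (modTheta (a * c * q⁻¹) p * thetaPoch (a * c * q ^ (k + l)) q p k) := by
    rw [hshift, eq_div_iff (mul_ne_zero n3 n2)]
    ring
  rw [hpow, add_zero, hac]
  clear_value N
  generalize thetaPoch (a * c * q⁻¹ * q ^ k) q p (k + l + 1) = x₁ at *
  generalize thetaPoch (a * c * q ^ (k + l)) q p k = x₂ at *
  generalize modTheta (a * c * q⁻¹) p = x₃ at *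
  generalize thetaPoch (c / a) q p (k + l) = x₄ at *
  generalize thetaPoch (c * z) q p k = x₅ at *
  generalize thetaPoch (c * z * q ^ k) q p l = x₆ at *
  generalize thetaPoch (c / z) q p k = x₇ at *
  generalize thetaPoch (c / z * q ^ k) q p l = x₈ at *
  generalize thetaPoch (a * c * q⁻¹) q p k = x₉
  generalize thetaPoch (q ^ (-N)) q p k = x₁₀
  generalize modTheta (a * c * q ^ (2 * (k : ℤ) - 1)) p = x₁₁
  generalize (c / a) ^ k = x₁₂
  clear * - n1 n2 n3 n4 m3 m4 m5 m6
  field_simp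

/-! ### Continuity, countable exceptional sets, and passage from generic to arbitrary `c`. -/

theorem continuousAt_thetaPoch {p q x : ℂ} (hp : ‖p‖ < 1) (hq : q ≠ 0) (hx : x ≠ 0) (n : ℕ) :
    ContinuousAt (fun x => thetaPoch x q p n) x := by
  refine tendsto_finsetProd _ fun j _ => ?_
  exact ContinuousAt.comp' (g := fun x => modTheta x p) (f := fun x => x * q ^ j)
    (continuousAt_modTheta hp (mul_ne_zero hx (pow_ne_zero j hq)))
    (continuousAt_id.mul continuousAt_const)

theorem continuousAt_cubicTheta {r x y : ℂ} (hr : ‖r‖ < 1) (hx : x ≠ 0) (hy : y ≠ 0) :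
    ContinuousAt (fun y => cubicTheta x y r) y := by
  have hr3 : ‖r ^ 3‖ < 1 := by
    rw [norm_pow]
    exact pow_lt_one₀ (norm_nonneg r) hr (by norm_num)
  refine (((continuousAt_thetaEven hr3 hy).mul (continuousAt_const (y := thetaEven r x))).add
    ((continuousAt_thetaOdd hr3 hy).mul
      (continuousAt_const (y := r * thetaOdd r x)))).congr ?_
  filter_upwards [isOpen_ne.mem_nhds hy] with w hw
  exact (cubicTheta_eq hr hx hw).symm

theorem countable_setOf_modTheta_eq_zero {p q t : ℂ} (hp : ‖p‖ < 1) (hq : q ≠ 0) (ht : t ≠ 0) :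
    {c : ℂ | ∃ j : ℤ, modTheta (t * c * q ^ j) p = 0}.Countable := by
  rw [Set.ofPred_exists]
  refine Set.countable_iUnion fun j => ?_
  refine (countable_modTheta_zeros hp).preimage (f := fun c => t * c * q ^ j) ?_
  intro c d h
  exact mul_left_cancel₀ ht (mul_right_cancel₀ (zpow_ne_zero j hq) h)

theorem thetaPochs_four (x₁ x₂ x₃ x₄ q p : ℂ) (n : ℕ) :
    thetaPochs [x₁, x₂, x₃, x₄] q p n = thetaPoch x₁ q p n
      * (thetaPoch x₂ q p n * (thetaPoch x₃ q p n * thetaPoch x₄ q p n)) := by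
  simp [thetaPochs]

theorem thetaPochs_two (x₁ x₂ q p : ℂ) (n : ℕ) :
    thetaPochs [x₁, x₂] q p n = thetaPoch x₁ q p n * thetaPoch x₂ q p n := by
  simp [thetaPochs]

theorem ContinuousAt.thetaPoch_const_mul {p q t c : ℂ} (hp : ‖p‖ < 1) (hq : q ≠ 0) (ht : t ≠ 0)
    (hc : c ≠ 0) {f : ℂ → ℂ} (hf : ∀ c, f c = t * c) (n : ℕ) :
    ContinuousAt (fun c => thetaPoch (f c) q p n) c := by
  simp only [hf]
  exact ContinuousAt.comp' (g := fun x => thetaPoch x q p n) (f := fun c => t * c)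
    (continuousAt_thetaPoch hp hq (mul_ne_zero ht hc) n) (continuousAt_const.mul continuousAt_id)

/-- The expansion with the cubic theta shifted factorials written out, for generic `c`. -/
theorem cubicTheta_expansion_generic {r q s a b c z : ℂ} {n : ℕ} (hr : ‖r‖ < 1) (hs : s ≠ 0)
    (hsq : s ^ 2 = q) (ha : a ≠ 0) (hb : b ≠ 0) (hc : c ≠ 0) (hz : z ≠ 0)
    (hY : ∀ j : ℤ, modTheta (a * c * q ^ j) (r ^ 3) ≠ 0)
    (hZ : ∀ j : ℤ, modTheta (c / a * q ^ j) (r ^ 3) ≠ 0)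
    (hW : ∀ j : ℤ, modTheta (c * z * q ^ j) (r ^ 3) ≠ 0)
    (hX : ∀ j : ℤ, modTheta (c / z * q ^ j) (r ^ 3) ≠ 0)
    (hQ : thetaPoch q q (r ^ 3) n ≠ 0) :
    shiftProd (fun j => cubicTheta (b * s ^ ((n : ℤ) - 1)) (z * s ^ (1 - (n : ℤ)) * q ^ j) r) 0 n
        / thetaPochs [c * z, c / z] q (r ^ 3) n * thetaPochs [a * c, c / a] q (r ^ 3) n =
      ∑ k ∈ Finset.range (n + 1),
        q ^ (n * k) * (c / a) ^ k
          * (modTheta (a * c * q ^ (2 * (k : ℤ) - 1)) (r ^ 3) / modTheta (a * c * q⁻¹) (r ^ 3))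
          * (thetaPochs [q ^ (-(n : ℤ)), a * c * q⁻¹, a * z, a / z] q (r ^ 3) k
              / thetaPochs [q, a * c * q ^ n, c * z, c / z] q (r ^ 3) k)
          * shiftProd (fun j => cubicTheta (b * s ^ ((n : ℤ) - 1))
              (c * s ^ ((n : ℤ) - 1) * q ^ j) r) 0 k
          * shiftProd (fun j => cubicTheta (b * s ^ ((n : ℤ) - 1))
              (a * s ^ (1 - (n : ℤ)) * q ^ j) r) k (n - k) := by
  have hq : q ≠ 0 := hsq ▸ pow_ne_zero 2 hs
  have hsn : ∀ j : ℤ, s ^ j ≠ 0 := fun j => zpow_ne_zero j hs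
  have e1 : a * s ^ (1 - (n : ℤ)) * (c * s ^ ((n : ℤ) - 1)) = a * c := by
    rw [mul_mul_mul_comm, ← zpow_add₀ hs, show 1 - (n : ℤ) + (n - 1) = 0 by ring, zpow_zero,
      mul_one]
  have e2 : c * s ^ ((n : ℤ) - 1) / (a * s ^ (1 - (n : ℤ))) = c / a * q ^ ((n : ℤ) - 1) := by
    rw [mul_div_mul_comm, ← zpow_sub₀ hs, ← hsq, ← zpow_ofNat, ← zpow_mul]
    congr 2
    ring
  rw [shiftProd_cubicTheta_eq_sum hr hq (mul_ne_zero ha (hsn (1 - (n : ℤ))))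
    (mul_ne_zero hc (hsn ((n : ℤ) - 1))) (mul_ne_zero hz (hsn _)) (mul_ne_zero hb (hsn _))
    (fun j => by rw [e1]; exact hY j)
    (fun j => by rw [e2, mul_assoc, ← zpow_add₀ hq]; exact hZ _) n hQ,
    Finset.sum_div, Finset.sum_mul]
  refine Finset.sum_congr rfl fun k hk => ?_
  obtain ⟨l, rfl⟩ := Nat.exists_eq_add_of_le (Nat.lt_succ_iff.mp (Finset.mem_range.mp hk))
  rw [Nat.add_sub_cancel_left, ← expansionCoeff_eq_thetaPoch hs hsq ha hc hz hY hZ hW hX rfl rfl rfl]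
  ring

/-- The expansion with the cubic theta shifted factorials written out. -/
theorem cubicTheta_expansion {r q s a b c z : ℂ} {n : ℕ} (hr : ‖r‖ < 1) (hs : s ≠ 0)
    (hsq : s ^ 2 = q) (ha : a ≠ 0) (hb : b ≠ 0) (hc : c ≠ 0) (hz : z ≠ 0)
    (h₁ : modTheta (a * c * q⁻¹) (r ^ 3) ≠ 0)
    (h₂ : thetaPochs [q, a * c * q ^ n, c * z, c / z] q (r ^ 3) n ≠ 0) :
    shiftProd (fun j => cubicTheta (b * s ^ ((n : ℤ) - 1)) (z * s ^ (1 - (n : ℤ)) * q ^ j) r) 0 n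
        / thetaPochs [c * z, c / z] q (r ^ 3) n * thetaPochs [a * c, c / a] q (r ^ 3) n =
      ∑ k ∈ Finset.range (n + 1),
        q ^ (n * k) * (c / a) ^ k
          * (modTheta (a * c * q ^ (2 * (k : ℤ) - 1)) (r ^ 3) / modTheta (a * c * q⁻¹) (r ^ 3))
          * (thetaPochs [q ^ (-(n : ℤ)), a * c * q⁻¹, a * z, a / z] q (r ^ 3) k
              / thetaPochs [q, a * c * q ^ n, c * z, c / z] q (r ^ 3) k)
          * shiftProd (fun j => cubicTheta (b * s ^ ((n : ℤ) - 1))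
              (c * s ^ ((n : ℤ) - 1) * q ^ j) r) 0 k
          * shiftProd (fun j => cubicTheta (b * s ^ ((n : ℤ) - 1))
              (a * s ^ (1 - (n : ℤ)) * q ^ j) r) k (n - k) := by
  have hq : q ≠ 0 := hsq ▸ pow_ne_zero 2 hs
  have hp : ‖r ^ 3‖ < 1 := by
    rw [norm_pow]
    exact pow_lt_one₀ (norm_nonneg r) hr (by norm_num)
  have hz' := inv_ne_zero hz
  have ha' := inv_ne_zero ha
  have hqn := pow_ne_zero n hq
  have hne : ∀ k ≤ n, thetaPochs [q, a * c * q ^ n, c * z, c / z] q (r ^ 3) k ≠ 0 := by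
    intro k hk
    rw [thetaPochs_four] at h₂ ⊢
    simp only [mul_ne_zero_iff] at h₂ ⊢
    exact ⟨thetaPoch_ne_zero_of_le hk h₂.1, thetaPoch_ne_zero_of_le hk h₂.2.1,
      thetaPoch_ne_zero_of_le hk h₂.2.2.1, thetaPoch_ne_zero_of_le hk h₂.2.2.2⟩
  have hQ : thetaPoch q q (r ^ 3) n ≠ 0 := by
    rw [thetaPochs_four] at h₂
    exact left_ne_zero_of_mul h₂
  have hcz : thetaPochs [c * z, c / z] q (r ^ 3) n ≠ 0 := by
    rw [thetaPochs_four] at h₂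
    rw [thetaPochs_two]
    exact right_ne_zero_of_mul (right_ne_zero_of_mul h₂)
  have cθ : ∀ t : ℂ, t ≠ 0 → ContinuousAt (fun c => modTheta (a * c * t) (r ^ 3)) c :=
    fun t ht => ContinuousAt.comp' (g := fun x => modTheta x (r ^ 3)) (f := fun c => a * c * t)
      (continuousAt_modTheta hp (mul_ne_zero (mul_ne_zero ha hc) ht))
      ((continuousAt_const.mul continuousAt_id).mul continuousAt_const)
  have cP : ∀ (t : ℂ) (f : ℂ → ℂ) (m : ℕ), t ≠ 0 → (∀ c, f c = t * c) →
      ContinuousAt (fun c => thetaPoch (f c) q (r ^ 3) m) c :=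
    fun t f m ht hf => ContinuousAt.thetaPoch_const_mul hp hq ht hc hf m
  have c1 : ∀ m, ContinuousAt (fun c => thetaPoch (a * c) q (r ^ 3) m) c :=
    fun m => cP a _ m ha fun _ => rfl
  have c2 : ∀ m, ContinuousAt (fun c => thetaPoch (c / a) q (r ^ 3) m) c :=
    fun m => cP a⁻¹ _ m ha' fun c => by ring
  have c3 : ∀ m, ContinuousAt (fun c => thetaPoch (c * z) q (r ^ 3) m) c :=
    fun m => cP z _ m hz fun c => by ring
  have c4 : ∀ m, ContinuousAt (fun c => thetaPoch (c / z) q (r ^ 3) m) c :=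
    fun m => cP z⁻¹ _ m hz' fun c => by ring
  have c5 : ∀ m, ContinuousAt (fun c => thetaPoch (a * c * q⁻¹) q (r ^ 3) m) c :=
    fun m => cP (a * q⁻¹) _ m (mul_ne_zero ha (inv_ne_zero hq)) fun c => by ring
  have c6 : ∀ m, ContinuousAt (fun c => thetaPoch (a * c * q ^ n) q (r ^ 3) m) c :=
    fun m => cP (a * q ^ n) _ m (mul_ne_zero ha hqn) fun c => by ring
  have c7 : ∀ k, ContinuousAt (fun c => shiftProd (fun j => cubicTheta (b * s ^ ((n : ℤ) - 1))
      (c * s ^ ((n : ℤ) - 1) * q ^ j) r) 0 k) c := fun k => by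
    refine tendsto_finsetProd _ fun j _ => ?_
    exact ContinuousAt.comp' (g := fun y => cubicTheta (b * s ^ ((n : ℤ) - 1)) y r)
      (f := fun c => c * s ^ ((n : ℤ) - 1) * q ^ ((0 : ℤ) + j))
      (continuousAt_cubicTheta hr (mul_ne_zero hb (zpow_ne_zero _ hs))
        (mul_ne_zero (mul_ne_zero hc (zpow_ne_zero _ hs)) (zpow_ne_zero _ hq)))
      ((continuousAt_id.mul continuousAt_const).mul continuousAt_const)
  -- The values of `c` excluded in the generic expansion. The condition `hQ` does not involve `c`,
  -- so it is taken from `h₂` instead.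
  let S : Set ℂ := {c | c = 0} ∪ {c | ∃ j : ℤ, modTheta (a * c * q ^ j) (r ^ 3) = 0}
    ∪ {c | ∃ j : ℤ, modTheta (a⁻¹ * c * q ^ j) (r ^ 3) = 0}
    ∪ {c | ∃ j : ℤ, modTheta (z * c * q ^ j) (r ^ 3) = 0}
    ∪ {c | ∃ j : ℤ, modTheta (z⁻¹ * c * q ^ j) (r ^ 3) = 0}
  have hS : S.Countable := ((((Set.countable_singleton (0 : ℂ)).union
    (countable_setOf_modTheta_eq_zero hp hq ha)).union
    (countable_setOf_modTheta_eq_zero hp hq ha')).union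
    (countable_setOf_modTheta_eq_zero hp hq hz)).union
    (countable_setOf_modTheta_eq_zero hp hq hz')
  -- A countable set has dense complement in `ℂ`, so `c` is a limit of generic parameters, even if
  -- it lies in `S` itself.
  have hcl : c ∈ closure Sᶜ := (hS.dense_compl ℝ) c
  have := mem_closure_iff_nhdsWithin_neBot.mp hcl
  let F : ℂ → ℂ := fun c =>
    shiftProd (fun j => cubicTheta (b * s ^ ((n : ℤ) - 1)) (z * s ^ (1 - (n : ℤ)) * q ^ j) r) 0 n
        / thetaPochs [c * z, c / z] q (r ^ 3) n * thetaPochs [a * c, c / a] q (r ^ 3) n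
  let G : ℂ → ℂ := fun c =>
      ∑ k ∈ Finset.range (n + 1),
        q ^ (n * k) * (c / a) ^ k
          * (modTheta (a * c * q ^ (2 * (k : ℤ) - 1)) (r ^ 3) / modTheta (a * c * q⁻¹) (r ^ 3))
          * (thetaPochs [q ^ (-(n : ℤ)), a * c * q⁻¹, a * z, a / z] q (r ^ 3) k
              / thetaPochs [q, a * c * q ^ n, c * z, c / z] q (r ^ 3) k)
          * shiftProd (fun j => cubicTheta (b * s ^ ((n : ℤ) - 1))
              (c * s ^ ((n : ℤ) - 1) * q ^ j) r) 0 k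
          * shiftProd (fun j => cubicTheta (b * s ^ ((n : ℤ) - 1))
              (a * s ^ (1 - (n : ℤ)) * q ^ j) r) k (n - k)
  have hF : ContinuousAt F c := by
    have d1 : ContinuousAt (fun c => thetaPochs [c * z, c / z] q (r ^ 3) n) c := by
      simp only [thetaPochs_two]
      exact (c3 n).mul (c4 n)
    have d2 : ContinuousAt (fun c => thetaPochs [a * c, c / a] q (r ^ 3) n) c := by
      simp only [thetaPochs_two]
      exact (c1 n).mul (c2 n)
    exact (continuousAt_const.div d1 hcz).mul d2
  have hG : ContinuousAt G c := by
    refine tendsto_finsetSum _ fun k hk => ?_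
    have hk' := Nat.lt_succ_iff.mp (Finset.mem_range.mp hk)
    refine ContinuousAt.mul (ContinuousAt.mul (ContinuousAt.mul (ContinuousAt.mul ?_ ?_) ?_)
      (c7 k)) continuousAt_const
    · exact continuousAt_const.mul ((continuousAt_id.div_const a).pow k)
    · exact (cθ _ (zpow_ne_zero _ hq)).div (cθ _ (inv_ne_zero hq)) h₁
    · refine ContinuousAt.div ?_ ?_ (hne k hk')
      · simp only [thetaPochs_four]
        exact continuousAt_const.mul ((c5 k).mul continuousAt_const)
      · simp only [thetaPochs_four]
        exact continuousAt_const.mul ((c6 k).mul ((c3 k).mul (c4 k)))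
  have hFG : ∀ᶠ d in 𝓝[Sᶜ] c, F d = G d := by
    filter_upwards [self_mem_nhdsWithin] with d hd
    simp only [S, Set.mem_compl_iff, Set.mem_union, Set.mem_ofPred_eq, not_or, not_exists] at hd
    obtain ⟨⟨⟨⟨h0, hY⟩, hZ⟩, hW⟩, hX⟩ := hd
    exact cubicTheta_expansion_generic hr hs hsq ha hb h0 hz hY
      (fun j => by rw [div_eq_inv_mul]; exact hZ j) (fun j => by rw [mul_comm d]; exact hW j)
      (fun j => by rw [div_eq_inv_mul]; exact hX j) hQ
  exact tendsto_nhds_unique ((hF.tendsto.mono_left nhdsWithin_le_nhds).congr' hFG)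
    (hG.tendsto.mono_left nhdsWithin_le_nhds)

theorem corollary3p6 (p r q a b c z : ℂ) (n : ℕ)
    (hp : ‖p‖ < 1) (hr : r ^ 3 = p)
    (hq : q ≠ 0) (ha : a ≠ 0) (hb : b ≠ 0) (hc : c ≠ 0) (hz : z ≠ 0)
    (h₁ : modTheta (a * c * q⁻¹) p ≠ 0)
    (h₂ : thetaPochs [q, a * c * q ^ n, c * z, c / z] q p n ≠ 0) :
    cubicPoch (b * z) (b / z) q r n / thetaPochs [c * z, c / z] q p n
        * thetaPochs [a * c, c / a] q p n =
      ∑ k ∈ Finset.range (n + 1),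
        q ^ (n * k) * (c / a) ^ k
          * (modTheta (a * c * q ^ (2 * (k : ℤ) - 1)) p / modTheta (a * c * q⁻¹) p)
          * (thetaPochs [q ^ (-(n : ℤ)), a * c * q⁻¹, a * z, a / z] q p k
              / thetaPochs [q, a * c * q ^ n, c * z, c / z] q p k)
          * cubicPoch (b * c * q ^ ((n : ℤ) - 1)) (b * q ^ (1 - (k : ℤ)) / c) q r k
          * cubicPoch (a * b * q ^ k) (b / a) q r (n - k) := by
  subst hr
  have hr : ‖r‖ < 1 := by
    by_contra! h
    rw [norm_pow] at hp
    exact absurd (one_le_pow₀ h (n := 3)) (not_le.mpr hp)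
  obtain ⟨s, rfl⟩ := IsAlgClosed.exists_pow_nat_eq q (n := 2) two_pos
  have hs : s ≠ 0 := by
    rintro rfl
    simp at hq
  have hsn : ∀ j : ℤ, s ^ j ≠ 0 := fun j => zpow_ne_zero j hs
  have hs2 : ∀ j : ℤ, (s ^ 2) ^ j = s ^ (2 * j) := fun j => by rw [zpow_mul, zpow_ofNat]
  rw [cubicPoch_eq_shiftProd (i := 0) hs hb hz rfl rfl rfl
      (show z * s ^ (1 - (n : ℤ)) * (s ^ 2) ^ (0 : ℤ) = z * s ^ (1 - (n : ℤ)) by simp),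
    cubicTheta_expansion hr hs rfl ha hb hc hz h₁ h₂]
  refine Finset.sum_congr rfl fun k hk => ?_
  obtain ⟨l, rfl⟩ := Nat.exists_eq_add_of_le (Nat.lt_succ_iff.mp (Finset.mem_range.mp hk))
  rw [Nat.add_sub_cancel_left]
  congr 1
  · congr 1
    -- Here `x` is forced by the common first argument, `x * s ^ (k - 1) = b * s ^ (n - 1)` with `n
    -- = k + l`, and `y` by the starting point, `y * s ^ (1 - k) = c * s ^ (n - 1)`.
    refine (cubicPoch_eq_shiftProd (x := b * s ^ (l : ℤ)) (y := c * s ^ (2 * (k : ℤ) + l - 2)) hs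
      (mul_ne_zero hb (hsn _)) (mul_ne_zero hc (hsn _)) ?_ ?_ ?_ ?_).symm
    · rw [hs2, mul_mul_mul_comm, ← zpow_add₀ hs]
      congr 2
      push_cast
      ring
    · rw [hs2, mul_div_mul_comm, ← zpow_sub₀ hs, mul_div_right_comm]
      congr 2
      ring
    · rw [mul_assoc, ← zpow_add₀ hs]
      congr 2
      push_cast
      ring
    · rw [zpow_zero, mul_one, mul_assoc, ← zpow_add₀ hs]
      congr 2
      push_cast
      ring
  -- The same matching for length `l`, where the block starts at index `k`: `x * s ^ (l - 1) = b * s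
  -- ^ (n - 1)` and `y * s ^ (1 - l) = a * s ^ (1 - n) * q ^ k`.
  · refine (cubicPoch_eq_shiftProd (x := b * s ^ (k : ℤ)) (y := a * s ^ (k : ℤ)) hs
      (mul_ne_zero hb (hsn _)) (mul_ne_zero ha (hsn _)) ?_ ?_ ?_ ?_).symm
    · rw [← zpow_natCast, hs2, mul_mul_mul_comm, ← zpow_add₀ hs, mul_comm a b]
      congr 2
      ring
    · rw [mul_div_mul_right _ _ (hsn _)]
    · rw [mul_assoc, ← zpow_add₀ hs]
      congr 2
      push_cast
      ring
    · rw [hs2, mul_assoc, ← zpow_add₀ hs, mul_assoc, ← zpow_add₀ hs]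
      congr 2
      push_cast
      ring
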